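/- Let $\mathfrak g_1,\mathfrak g_2$ be three-dimensional real Lie algebras and $\mathfrak g=\mathfrak g_1\oplus\mathfrak g_2$ their direct sum. An $\mathrm{SU}(3)$-structure $(g,J,\omega,\Psi)$ on $\mathfrak g$ consists of a positive definite scalar product $g$, a $g$-orthogonal complex structure $J$ on the vector space $\mathfrak g$ (no integrability is required), the two-form $\omega=g(\cdot,J\cdot)$ and a non-zero complex-valued $(3,0)$-form $\Psi$. It is half-flat if $d(\omega\wedge\omega)=0$ and $d(\mathrm{Re}\,\Psi)=0$, where $d$ is the Chevalley–Eilenberg differential of $\mathfrak g$. If $\mathfrak g_1\perp\mathfrak g_2$, there are orthonormal bases $e_1,e_2,e_3$ of $\mathfrak g_1$ and $f_1,f_2,f_3$ of $\mathfrak g_2$, with dual bases $e^i$, $f^i$, and a real number $-1<a\le 1$ such that $$\omega=a\,e^{12}+\sqrt{1-a^2}\,e^1\wedge f^1+\sqrt{1-a^2}\,e^2\wedge f^2+e^3\wedge f^3-a\,f^{12};$$ the structure is of type I if it admits such bases with $a=0$, and of type II if it admits such bases with $a\neq0$. (1) $\mathfrak g$ admits a half-flat $\mathrm{SU}(3)$-structure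 of type I with $\mathfrak g_1\perp\mathfrak g_2$ if and only if either $\mathfrak g_1\cong\mathfrak g_2$ and both are unimodular, or one of $\mathfrak g_1,\mathfrak g_2$ is non-abelian and unimodular and the other one is abelian. (2) $\mathfrak g$ admits a half-flat $\mathrm{SU}(3)$-structure of type II with $\mathfrak g_1\perp\mathfrak g_2$ if and only if, up to isomorphism of each entry, $(\mathfrak g_1,\mathfrak g_2)$ or $(\mathfrak g_2,\mathfrak g_1)$ is one of the pairs $$(\mathbb R^3,\mathbb R^3),\quad(\mathfrak e(1,1),\mathfrak e(1,1)),\quad(\mathfrak e(2),\mathbb R\oplus\mathfrak r_2),\quad(\mathfrak{su}(2),\mathfrak r_{3,\mu})\ \text{with}\ 0<\mu\le1,\quad(\mathfrak{sl}(2,\mathbb R),\mathfrak r_{3,\mu})\ \text{with}\ -1<\mu<0.$$ Here $\mathbb R^3$ is abelian, and the remaining solvable algebras have a basis $x_1,x_2,x_3$ with $[x_2,x_3]=0$ and, respectively, $[x_1,x_2]=-x_3,\ [x_1,x_3]=x_2$ for $\mathfrak e(2)$; $[x_1,x_2]=x_3,\ [x_1,x_3]=x_2$ for $\mathfrak e(1,1)$;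 $[x_1,x_2]=x_2,\ [x_1,x_3]=0$ for $\mathbb R\oplus\mathfrak r_2$; $[x_1,x_2]=x_2,\ [x_1,x_3]=\mu x_3$ for $\mathfrak r_{3,\mu}$. -/

import Mathlib

namespace HalfFlat

section Forms

/-- The wedge product of two real-valued alternating forms (a sum over shuffles, so that
`(α ∧ β)(u, v) = α(u) β(v) - α(v) β(u)` for one-forms). -/
noncomputable def wedge {V : Type*} [AddCommGroup V] [Module ℝ V] {p q : ℕ}
    (α : V [⋀^Fin p]→ₗ[ℝ] ℝ) (β : V [⋀^Fin q]→ₗ[ℝ] ℝ) : V [⋀^Fin (p + q)]→ₗ[ℝ] ℝ :=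
  ((LinearMap.mul' ℝ ℝ).compAlternatingMap (α.domCoprod β)).domDomCongr finSumFinEquiv

/-- The value at `(x₀, …, x_{n+1})` of the Chevalley–Eilenberg differential `dα` of an
`(n+1)`-form `α` on a real Lie algebra (trivial coefficients):
`dα(x₀, …, x_{n+1}) = ∑_{i < j} (-1)^(i+j) α([xᵢ, xⱼ], x₀, …, x̂ᵢ, …, x̂ⱼ, …, x_{n+1})`.
On one-forms this is `dα(x, y) = -α([x, y])`. The index `i : Fin (n + 1)` stands for the element
`i.castSucc` of `Fin (n + 2)`, and for `i.castSucc < j` the family `k ↦ x (j.succAbove (i.succAbove k))`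
is the family `x` with its entries at `i` and `j` removed. -/
def ceDiff {L : Type*} [LieRing L] [LieAlgebra ℝ L] {n : ℕ}
    (α : L [⋀^Fin (n + 1)]→ₗ[ℝ] ℝ) (x : Fin (n + 2) → L) : ℝ :=
  ∑ j : Fin (n + 2), ∑ i : Fin (n + 1),
    if i.castSucc < j then
      (-1 : ℝ) ^ ((i : ℕ) + (j : ℕ)) *
        α (Fin.cons ⁅x i.castSucc, x j⁆ fun k : Fin n => x (j.succAbove (i.succAbove k)))
    else 0

/-- A form on a Lie algebra is closed if its Chevalley–Eilenberg differential vanishes. -/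
def IsClosedForm {L : Type*} [LieRing L] [LieAlgebra ℝ L] {n : ℕ}
    (α : L [⋀^Fin (n + 1)]→ₗ[ℝ] ℝ) : Prop :=
  ∀ x : Fin (n + 2) → L, ceDiff α x = 0

/-- The value `(α ∧ β)(u, v)` of the wedge product of two one-forms. -/
def wedgeOne {V : Type*} [AddCommGroup V] [Module ℝ V] (α β : V →ₗ[ℝ] ℝ) (u v : V) : ℝ :=
  α u * β v - α v * β u

end Forms

/-- A linear `SU(3)`-structure `(g, J, ω, Ψ)` on a (six-dimensional) real vector space: a positive
definite scalar product `g`, an orthogonal complex structure `J`, the fundamental two-form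
`ω = g(·, J ·)` and a non-zero complex-valued `(3,0)`-form `Ψ`. -/
structure SU3Structure (V : Type*) [AddCommGroup V] [Module ℝ V] where
  g : LinearMap.BilinForm ℝ V
  g_symm : ∀ x y, g x y = g y x
  g_pos : ∀ x, x ≠ 0 → 0 < g x x
  J : V →ₗ[ℝ] V
  J_sq : ∀ x, J (J x) = -x
  J_orthogonal : ∀ x y, g (J x) (J y) = g x y
  ω : V [⋀^Fin 2]→ₗ[ℝ] ℝ
  ω_eq : ∀ x y, ω ![x, y] = g x (J y)
  Ψ : V [⋀^Fin 3]→ₗ[ℝ] ℂ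
  Ψ_type : ∀ x y z, Ψ ![J x, y, z] = Complex.I * Ψ ![x, y, z]
  Ψ_ne_zero : Ψ ≠ 0

namespace SU3Structure

/-- The real part of the `(3,0)`-form. -/
noncomputable def rePsi {V : Type*} [AddCommGroup V] [Module ℝ V] (S : SU3Structure V) :
    V [⋀^Fin 3]→ₗ[ℝ] ℝ :=
  Complex.reLm.compAlternatingMap S.Ψ

/-- Half-flatness: `d(ω ∧ ω) = 0` and `d(Re Ψ) = 0`. -/
def IsHalfFlat {L : Type*} [LieRing L] [LieAlgebra ℝ L] (S : SU3Structure L) : Prop :=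
  IsClosedForm (n := 3) (wedge (p := 2) (q := 2) S.ω S.ω) ∧ IsClosedForm (n := 2) S.rePsi

section Product

variable {V₁ V₂ : Type*} [AddCommGroup V₁] [Module ℝ V₁] [AddCommGroup V₂] [Module ℝ V₂]

/-- The two summands are mutually orthogonal. -/
def SummandsOrthogonal (S : SU3Structure (V₁ × V₂)) : Prop :=
  ∀ (x : V₁) (y : V₂), S.g (x, 0) (0, y) = 0

/-- There are `g`-orthonormal bases `e₁, e₂, e₃` of the first and `f₁, f₂, f₃` of the second summand
with `ω = a e¹² + √(1-a²) e¹f¹ + √(1-a²) e²f² + e³f³ - a f¹²`. -/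
def HasNormalForm (S : SU3Structure (V₁ × V₂)) (a : ℝ) : Prop :=
  ∃ (e : Module.Basis (Fin 3) ℝ V₁) (f : Module.Basis (Fin 3) ℝ V₂),
    (∀ i j, S.g (e i, 0) (e j, 0) = if i = j then 1 else 0) ∧
    (∀ i j, S.g (0, f i) (0, f j) = if i = j then 1 else 0) ∧
    let ε : Fin 3 → (V₁ × V₂ →ₗ[ℝ] ℝ) := fun i => e.coord i ∘ₗ LinearMap.fst ℝ V₁ V₂
    let φ : Fin 3 → (V₁ × V₂ →ₗ[ℝ] ℝ) := fun i => f.coord i ∘ₗ LinearMap.snd ℝ V₁ V₂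
    ∀ u v : V₁ × V₂, S.ω ![u, v] =
      a * wedgeOne (ε 0) (ε 1) u v
        + Real.sqrt (1 - a ^ 2) * wedgeOne (ε 0) (φ 0) u v
        + Real.sqrt (1 - a ^ 2) * wedgeOne (ε 1) (φ 1) u v
        + wedgeOne (ε 2) (φ 2) u v
        - a * wedgeOne (φ 0) (φ 1) u v

/-- The underlying Hermitian structure is of type I: it admits a normal form with `a = 0`. -/
def IsTypeI (S : SU3Structure (V₁ × V₂)) : Prop := S.HasNormalForm 0

/-- The underlying Hermitian structure is of type II: it admits a normal form with `a ≠ 0`. -/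
def IsTypeII (S : SU3Structure (V₁ × V₂)) : Prop :=
  ∃ a : ℝ, -1 < a ∧ a ≤ 1 ∧ a ≠ 0 ∧ S.HasNormalForm a

end Product

end SU3Structure

/-- A real Lie algebra is unimodular if `tr (ad x) = 0` for all `x`. -/
def IsUnimodular (L : Type*) [LieRing L] [LieAlgebra ℝ L] : Prop :=
  ∀ x : L, LinearMap.trace ℝ L (LieAlgebra.ad ℝ L x) = 0

/-- Isomorphism of real Lie algebras. -/
def Iso (L M : Type*) [LieRing L] [LieAlgebra ℝ L] [LieRing M] [LieAlgebra ℝ M] : Prop :=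
  Nonempty (L ≃ₗ⁅ℝ⁆ M)

/-- The underlying space of the three-dimensional Lie algebra `ℝ ⋉_A ℝ²`. -/
def PlaneExt (_A : Matrix (Fin 2) (Fin 2) ℝ) : Type := ℝ × (Fin 2 → ℝ)

namespace PlaneExt

variable (A : Matrix (Fin 2) (Fin 2) ℝ)

instance : AddCommGroup (PlaneExt A) := inferInstanceAs (AddCommGroup (ℝ × (Fin 2 → ℝ)))

noncomputable instance : Module ℝ (PlaneExt A) := inferInstanceAs (Module ℝ (ℝ × (Fin 2 → ℝ)))

/-- The bracket of `ℝ ⋉_A ℝ²`: `ℝ²` is an abelian ideal on which `(1, 0)` acts by `A`, that is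
`[(s, v), (t, w)] = (0, s • A w - t • A v)`. -/
noncomputable instance : Bracket (PlaneExt A) (PlaneExt A) where
  bracket x y := ((0 : ℝ), x.1 • A.mulVec y.2 - y.1 • A.mulVec x.2)

theorem bracket_def (x y : PlaneExt A) :
    ⁅x, y⁆ = (((0 : ℝ), x.1 • A.mulVec y.2 - y.1 • A.mulVec x.2) : ℝ × (Fin 2 → ℝ)) := rfl


noncomputable instance : LieRing (PlaneExt A) where
  add_lie x y z := by
    refine Prod.ext (add_zero (0 : ℝ)).symm ?_
    change (x.1 + y.1) • A.mulVec z.2 - z.1 • A.mulVec (x.2 + y.2) =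
      (x.1 • A.mulVec z.2 - z.1 • A.mulVec x.2) + (y.1 • A.mulVec z.2 - z.1 • A.mulVec y.2)
    rw [Matrix.mulVec_add]; module
  lie_add x y z := by
    refine Prod.ext (add_zero (0 : ℝ)).symm ?_
    change x.1 • A.mulVec (y.2 + z.2) - (y.1 + z.1) • A.mulVec x.2 =
      (x.1 • A.mulVec y.2 - y.1 • A.mulVec x.2) + (x.1 • A.mulVec z.2 - z.1 • A.mulVec x.2)
    rw [Matrix.mulVec_add]; module
  lie_self x := Prod.ext rfl (sub_self _)
  leibniz_lie x y z := by
    refine Prod.ext (add_zero (0 : ℝ)).symm ?_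
    change x.1 • A.mulVec (y.1 • A.mulVec z.2 - z.1 • A.mulVec y.2) - (0 : ℝ) • A.mulVec x.2 =
      ((0 : ℝ) • A.mulVec z.2 - z.1 • A.mulVec (x.1 • A.mulVec y.2 - y.1 • A.mulVec x.2)) +
      (y.1 • A.mulVec (x.1 • A.mulVec z.2 - z.1 • A.mulVec x.2) - (0 : ℝ) • A.mulVec y.2)
    simp only [Matrix.mulVec_sub, Matrix.mulVec_smul]; module

noncomputable instance : LieAlgebra ℝ (PlaneExt A) where
  lie_smul t x y := by
    refine Prod.ext (mul_zero t).symm ?_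
    change x.1 • A.mulVec (t • y.2) - (t * y.1) • A.mulVec x.2 =
      t • (x.1 • A.mulVec y.2 - y.1 • A.mulVec x.2)
    rw [Matrix.mulVec_smul]; module

end PlaneExt

/-- `e(2)`: standard bracket `de² = e³¹`, `de³ = e¹²`. -/
abbrev e2 : Type := PlaneExt !![0, 1; -1, 0]

/-- `e(1,1)`: standard bracket `de² = e³¹`, `de³ = e²¹`. -/
abbrev e11 : Type := PlaneExt !![0, 1; 1, 0]

/-- `r_{3,μ}`: standard bracket `de² = e²¹`, `de³ = μ e³¹`. -/
abbrev r3 (μ : ℝ) : Type := PlaneExt !![1, 0; 0, μ]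

/-- `ℝ ⊕ r₂`: standard bracket `de² = e²¹`. -/
abbrev Rr2 : Type := PlaneExt !![1, 0; 0, 0]

section MatrixAlgebras

attribute [local instance] LieRing.ofAssociativeRing

/-- The Lie algebra `su(2)` of skew-Hermitian trace-free complex `2 × 2` matrices. -/
def su2 : LieSubalgebra ℝ (Matrix (Fin 2) (Fin 2) ℂ) where
  carrier := {X | X.conjTranspose = -X ∧ X.trace = 0}
  zero_mem' := by simp
  add_mem' := by
    rintro X Y ⟨hX, hX'⟩ ⟨hY, hY'⟩
    refine ⟨?_, by simp [hX', hY']⟩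
    rw [Matrix.conjTranspose_add, hX, hY, neg_add]
  smul_mem' := by
    rintro t X ⟨hX, hX'⟩
    refine ⟨?_, by simp [hX']⟩
    rw [Matrix.conjTranspose_smul, hX, star_trivial, smul_neg]
  lie_mem' := by
    rintro X Y ⟨hX, hX'⟩ ⟨hY, hY'⟩
    refine ⟨?_, by rw [Ring.lie_def, Matrix.trace_sub, Matrix.trace_mul_comm, sub_self]⟩
    rw [Ring.lie_def, Matrix.conjTranspose_sub, Matrix.conjTranspose_mul,
      Matrix.conjTranspose_mul, hX, hY]
    noncomm_ring

/-- The Lie algebra `sl(2, ℝ)`. -/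
abbrev sl2 : LieSubalgebra ℝ (Matrix (Fin 2) (Fin 2) ℝ) :=
  LieAlgebra.SpecialLinear.sl (Fin 2) ℝ

end MatrixAlgebras

end HalfFlat

/-! ### Wedge products and closedness evaluated on a basis. -/

namespace HalfFlat
open AlternatingMap

/-! A bracket on a three-dimensional space is a linear map from Λ²L to L, hence, after choosing a
basis, a 3 × 3 matrix (`HasStructure`); unimodularity says that this matrix is symmetric. In a
normal frame e, f a (3,0)-form is c = α + iβ times a fixed form θ¹∧θ²∧θ³, so half-flatness becomes a
system of linear equations in the structure matrices A, B with coefficients in a, √(1-a²), α, β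
(`HalfFlatEquations`). Conversely a solution rebuilds the SU(3)-structure (`exists_halfFlat_iff`),
and what remains is linear algebra over structure matrices up to change of basis (`Admits.congr`).

For a = 0 the system says that A and B are symmetric and βA + αB = 0: either the matrices are
proportional, and rescaling a basis gives an isomorphism, or one of them vanishes.

For a ≠ 0 both matrices split into a 2 × 2 block and a corner entry (`HalfFlatEquations.block`). If
the corner of A is non-zero, the Jacobi identity makes A symmetric. The equations then force the
corner of B to vanish, the second algebra to be a non-unimodular ℝ ⋉ ℝ² with symmetric action, and
the product of the corner and the block trace of A to be positive. A comparison of determinants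
(`HalfFlatEquations.det_eq`) shows that det of the block of A has the sign of det of the action.
This common sign separates su(2), e(2), sl(2,ℝ) on one side and r_{3,μ} with μ > 0, ℝ ⊕ r₂, r_{3,μ}
with μ < 0 on the other. If both corners vanish, both blocks are symmetric and trace-free, and both
algebras are abelian or both are e(1,1). Conversely, one explicit family of solutions with a = 1
(`halfFlatEquations_planar`) realizes every non-abelian pair. -/

theorem sum_perm_fin_succ {M : Type*} [AddCommMonoid M] {n : ℕ} (f : Equiv.Perm (Fin (n + 1)) → M) :
    ∑ σ, f σ = ∑ i, ∑ τ, f (Equiv.Perm.decomposeFin.symm (i, τ)) := by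
  rw [← Equiv.sum_comp Equiv.Perm.decomposeFin.symm, Fintype.sum_prod_type]

/-- Alternating α ⊗ β over all 24 permutations counts each of the six shuffles 2!·2! = 4 times; the
sum is enumerated and divided by 4. -/
theorem wedge_two_two {V : Type*} [AddCommGroup V] [Module ℝ V] (α β : V [⋀^Fin 2]→ₗ[ℝ] ℝ)
    (x : Fin 4 → V) :
    wedge α β x = α ![x 0, x 1] * β ![x 2, x 3] - α ![x 0, x 2] * β ![x 1, x 3]
      + α ![x 0, x 3] * β ![x 1, x 2] + α ![x 1, x 2] * β ![x 0, x 3]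
      - α ![x 1, x 3] * β ![x 0, x 2] + α ![x 2, x 3] * β ![x 0, x 1] := by
  have h := MultilinearMap.domCoprod_alternization_eq α β
  have h2 := congrArg (fun F : V [⋀^(Fin 2 ⊕ Fin 2)]→ₗ[ℝ] (TensorProduct ℝ ℝ ℝ) =>
    LinearMap.mul' ℝ ℝ (F (x ∘ finSumFinEquiv))) h
  have h3 : (4:ℝ) * wedge α β x = LinearMap.mul' ℝ ℝ ((((2).factorial * (2).factorial : ℕ) •
      α.domCoprod β) (x ∘ finSumFinEquiv)) := by
    rw [AlternatingMap.smul_apply, map_nsmul]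
    simp [wedge, Nat.factorial]
  simp only [Fintype.card_fin] at h2
  rw [← h2, MultilinearMap.alternatization_apply, map_sum,
    ← Equiv.sum_comp (finSumFinEquiv (m := 2) (n := 2)).symm.permCongr] at h3
  have h4 : ∀ σ : Equiv.Perm (Fin 4), (LinearMap.mul' ℝ ℝ)
        (Equiv.Perm.sign ((finSumFinEquiv (m := 2) (n := 2)).symm.permCongr σ) •
          (MultilinearMap.domDomCongr ((finSumFinEquiv (m := 2) (n := 2)).symm.permCongr σ)
            ((α : MultilinearMap ℝ (fun _ => V) ℝ).domCoprod ↑β)) (x ∘ ⇑finSumFinEquiv))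
      = ((Equiv.Perm.sign σ : ℤ) : ℝ) * (α ![x (σ 0), x (σ 1)] * β ![x (σ 2), x (σ 3)]) := by
    intro σ
    have e1 : ∀ v : Fin 2 → V, v = ![v 0, v 1] := fun v => by
      ext i; fin_cases i <;> rfl
    rw [Equiv.Perm.sign_permCongr, Units.smul_def, map_zsmul, zsmul_eq_mul]
    congr 1
    simp only [MultilinearMap.domDomCongr_apply, MultilinearMap.domCoprod_apply,
      LinearMap.mul'_apply]
    congr 1
    · rw [e1 ((fun i₁ => _))]
      simp [Equiv.permCongr_apply]; rfl
    · rw [e1 ((fun i₁ => _))]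
      simp [Equiv.permCongr_apply]; rfl
  simp only [h4] at h3
  have a1 : ∀ u v, α ![u, v] = - α ![v, u] := fun u v => by
    have := α.map_swap ![v, u] (show (0 : Fin 2) ≠ 1 by decide)
    rw [← this]; congr 1; ext i; fin_cases i <;> rfl
  have b1 : ∀ u v, β ![u, v] = - β ![v, u] := fun u v => by
    have := β.map_swap ![v, u] (show (0 : Fin 2) ≠ 1 by decide)
    rw [← this]; congr 1; ext i; fin_cases i <;> rfl
  have d2 : ∀ a τ, Equiv.Perm.decomposeFin.symm (a, τ) (2 : Fin 4) = Equiv.swap 0 a (τ 1).succ :=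
    fun a τ => Equiv.Perm.decomposeFin_symm_apply_succ τ a 1
  have d3 : ∀ a τ, Equiv.Perm.decomposeFin.symm (a, τ) (3 : Fin 4) = Equiv.swap 0 a (τ 2).succ :=
    fun a τ => Equiv.Perm.decomposeFin_symm_apply_succ τ a 2
  have d2' : ∀ a τ, Equiv.Perm.decomposeFin.symm (a, τ) (2 : Fin 3) = Equiv.swap 0 a (τ 1).succ :=
    fun a τ => Equiv.Perm.decomposeFin_symm_apply_succ τ a 1
  simp only [sum_perm_fin_succ, Fin.sum_univ_succ, Finset.univ_unique, Finset.sum_singleton] at h3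
  simp [Equiv.Perm.decomposeFin.symm_sign, Fin.succ_one_eq_two, Equiv.swap_apply_def,
    Fin.ext_iff, d2, d3, d2'] at h3
  rw [a1 (x 1) (x 0), a1 (x 2) (x 0), a1 (x 3) (x 0), a1 (x 2) (x 1), a1 (x 3) (x 1), a1 (x 3) (x 2),
    b1 (x 1) (x 0), b1 (x 2) (x 0), b1 (x 3) (x 0), b1 (x 2) (x 1), b1 (x 3) (x 1),
    b1 (x 3) (x 2)] at h3
  linear_combination (1 / 4) * h3

/-- The Chevalley–Eilenberg differential of a form is an alternating form. -/
theorem exists_alternatingMap_eq_ceDiff {L : Type*} [LieRing L] [LieAlgebra ℝ L] {n : ℕ}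
    (α : L [⋀^Fin (n + 1)]→ₗ[ℝ] ℝ) :
    ∃ D : L [⋀^Fin (n + 2)]→ₗ[ℝ] ℝ, ∀ x, D x = ceDiff α x := by
  let F : L →ₗ[ℝ] L →ₗ[ℝ] L [⋀^Fin n]→ₗ[ℝ] ℝ :=
    LinearMap.compr₂ (LieModule.toEnd ℝ L L : L →ₗ[ℝ] L →ₗ[ℝ] L) α.curryLeft
  have hF : ∀ u v w, F u v w = α (Fin.cons ⁅u, v⁆ w) := fun u v w => rfl
  -- Uncurrying twice inserts each pair of arguments in both orders, which doubles the sum because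
  -- the bracket is skew; this gives the 1/2. The minus sign comes from naming the later index
  -- `j.succ`, which shifts the parity of i + j by one.
  refine ⟨(-(1/2) : ℝ) • alternatizeUncurryFin (alternatizeUncurryFinLM ∘ₗ F), fun x => ?_⟩
  rw [AlternatingMap.smul_apply, alternatizeUncurryFin_alternatizeUncurryFinLM_comp_apply]
  have hskew : ∀ u v w, F v u w = - F u v w := by
    intro u v w
    rw [hF, hF, ← lie_skew]
    exact (α.curryLeft.map_neg ⁅u,v⁆ ▸ rfl : α.curryLeft (-⁅u,v⁆) w = - α.curryLeft (⁅u,v⁆) w)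
  simp only [ceDiff]
  rw [Finset.sum_comm, Finset.smul_sum]
  refine Finset.sum_congr rfl fun i _ => ?_
  rw [Fin.sum_univ_succ, if_neg (by simp), zero_add]
  rw [Finset.smul_sum, ← Finset.filter_le_eq_Ici, Finset.sum_filter]
  refine Finset.sum_congr rfl fun j _ => ?_
  simp only [Fin.castSucc_lt_succ_iff]
  split_ifs with hij
  · rw [hskew (x i.castSucc) (x j.succ), hF]
    have : (j.removeNth (i.castSucc.removeNth x)) =
        fun k => x (j.succ.succAbove (i.succAbove k)) := by
      rw [Fin.removeNth_removeNth_eq_swap]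
      simp [Fin.predAbove, not_lt.mpr hij,
        Fin.succAbove_of_le_castSucc _ _ (Fin.castSucc_le_castSucc_iff.mpr hij)]
      rfl
    rw [this]
    simp [pow_succ, ← add_assoc]
    ring
  · simp

theorem ceDiff_three {L : Type*} [LieRing L] [LieAlgebra ℝ L] (α : L [⋀^Fin 3]→ₗ[ℝ] ℝ)
    (x₀ x₁ x₂ x₃ : L) :
    ceDiff (n := 2) α ![x₀, x₁, x₂, x₃] =
      -α ![⁅x₀, x₁⁆, x₂, x₃] + α ![⁅x₀, x₂⁆, x₁, x₃] - α ![⁅x₀, x₃⁆, x₁, x₂]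
        - α ![⁅x₁, x₂⁆, x₀, x₃] + α ![⁅x₁, x₃⁆, x₀, x₂] - α ![⁅x₂, x₃⁆, x₀, x₁] := by
  have e : ∀ (u : L) (v : Fin 2 → L), (Fin.cons u v : Fin 3 → L) = ![u, v 0, v 1] := by
    intro u v; ext i; fin_cases i <;> rfl
  simp [ceDiff, Fin.sum_univ_succ, e, Fin.succAbove]
  norm_num
  ring

theorem ceDiff_four {L : Type*} [LieRing L] [LieAlgebra ℝ L] (α : L [⋀^Fin 4]→ₗ[ℝ] ℝ)
    (x₀ x₁ x₂ x₃ x₄ : L) :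
    ceDiff (n := 3) α ![x₀, x₁, x₂, x₃, x₄] =
      -α ![⁅x₀, x₁⁆, x₂, x₃, x₄] + α ![⁅x₀, x₂⁆, x₁, x₃, x₄] - α ![⁅x₀, x₃⁆, x₁, x₂, x₄]
        + α ![⁅x₀, x₄⁆, x₁, x₂, x₃]
        - α ![⁅x₁, x₂⁆, x₀, x₃, x₄] + α ![⁅x₁, x₃⁆, x₀, x₂, x₄] - α ![⁅x₁, x₄⁆, x₀, x₂, x₃]
        - α ![⁅x₂, x₃⁆, x₀, x₁, x₄] + α ![⁅x₂, x₄⁆, x₀, x₁, x₃] - α ![⁅x₃, x₄⁆, x₀, x₁, x₂] := by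
  have e : ∀ (u : L) (v : Fin 3 → L), (Fin.cons u v : Fin 4 → L) = ![u, v 0, v 1, v 2] := by
    intro u v; ext i; fin_cases i <;> rfl
  simp [ceDiff, Fin.sum_univ_succ, e, Fin.succAbove]
  norm_num
  ring

/-- Sorting an injective tuple of indices changes the value of an alternating form only by a sign.
Closedness in dimension six is thereby reduced to 15 equations for a 3-form and 6 for a 4-form. -/
theorem eq_zero_of_strictMono {V : Type*} [AddCommGroup V] [Module ℝ V] {m n : ℕ}
    (b : Module.Basis (Fin m) ℝ V) (D : V [⋀^Fin n]→ₗ[ℝ] ℝ)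
    (h : ∀ v : Fin n → Fin m, StrictMono v → D (fun i => b (v i)) = 0) : D = 0 := by
  refine b.ext_alternating fun v hv => ?_
  have h1 := h (v ∘ Tuple.sort v)
    ((Tuple.monotone_sort v).strictMono_of_injective (hv.comp (Tuple.sort v).injective))
  have h2 := D.map_perm (fun i => b (v i)) (Tuple.sort v)
  simp only [Function.comp_def] at h1 h2
  rw [h1] at h2
  exact (smul_eq_zero_iff_eq _).1 h2.symm

theorem isClosedForm_three_iff {L : Type*} [LieRing L] [LieAlgebra ℝ L]
    (b : Module.Basis (Fin 6) ℝ L) (α : L [⋀^Fin 3]→ₗ[ℝ] ℝ) :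
    IsClosedForm (n := 2) α ↔ ∀ i j k l, i < j → j < k → k < l →
      ceDiff (n := 2) α ![b i, b j, b k, b l] = 0 := by
  refine ⟨fun h i j k l _ _ _ => h _, fun h => ?_⟩
  obtain ⟨D, hD⟩ := exists_alternatingMap_eq_ceDiff (n := 2) α
  have : D = 0 := by
    refine eq_zero_of_strictMono b D fun v hv => ?_
    have := h (v 0) (v 1) (v 2) (v 3) (hv (by decide)) (hv (by decide)) (hv (by decide))
    rw [hD, ← this]
    congr 1
    ext i; fin_cases i <;> rfl
  intro x
  rw [← hD, this]; rfl

theorem isClosedForm_four_iff {L : Type*} [LieRing L] [LieAlgebra ℝ L]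
    (b : Module.Basis (Fin 6) ℝ L) (α : L [⋀^Fin 4]→ₗ[ℝ] ℝ) :
    IsClosedForm (n := 3) α ↔ ∀ i j k l m, i < j → j < k → k < l → l < m →
      ceDiff (n := 3) α ![b i, b j, b k, b l, b m] = 0 := by
  refine ⟨fun h i j k l m _ _ _ _ => h _, fun h => ?_⟩
  obtain ⟨D, hD⟩ := exists_alternatingMap_eq_ceDiff (n := 3) α
  have : D = 0 := by
    refine eq_zero_of_strictMono b D fun v hv => ?_
    have := h (v 0) (v 1) (v 2) (v 3) (v 4) (hv (by decide)) (hv (by decide)) (hv (by decide))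
      (hv (by decide))
    rw [hD, ← this]
    congr 1
    ext i; fin_cases i <;> rfl
  intro x
  rw [← hD, this]; rfl

end HalfFlat

namespace HalfFlat
open Module

/-! ### Normal frames and the (3,0)-form. -/

section Frames

variable {V₁ V₂ : Type*} [AddCommGroup V₁] [Module ℝ V₁] [AddCommGroup V₂] [Module ℝ V₂]

/-- The two bases form an orthonormal frame in which `ω` has its normal form with parameter `a`. -/
def IsNormalFrame (S : SU3Structure (V₁ × V₂)) (a : ℝ) (e : Basis (Fin 3) ℝ V₁)
    (f : Basis (Fin 3) ℝ V₂) : Prop :=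
  (∀ i j, S.g (e i, 0) (e j, 0) = if i = j then 1 else 0) ∧
    (∀ i j, S.g (0, f i) (0, f j) = if i = j then 1 else 0) ∧
    ∀ u v : V₁ × V₂, S.ω ![u, v] =
      a * (e.repr u.1 0 * e.repr v.1 1 - e.repr v.1 0 * e.repr u.1 1)
        + √(1 - a ^ 2) * (e.repr u.1 0 * f.repr v.2 0 - e.repr v.1 0 * f.repr u.2 0)
        + √(1 - a ^ 2) * (e.repr u.1 1 * f.repr v.2 1 - e.repr v.1 1 * f.repr u.2 1)
        + (e.repr u.1 2 * f.repr v.2 2 - e.repr v.1 2 * f.repr u.2 2)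
        - a * (f.repr u.2 0 * f.repr v.2 1 - f.repr v.2 0 * f.repr u.2 1)

/-- The complex linear forms spanning the `(1,0)`-forms in a normal frame. -/
noncomputable def theta (a : ℝ) (e : Basis (Fin 3) ℝ V₁) (f : Basis (Fin 3) ℝ V₂)
    (x : V₁ × V₂) : Fin 3 → ℂ :=
  ![⟨e.repr x.1 0, -(a * e.repr x.1 1 + √(1 - a ^ 2) * f.repr x.2 0)⟩,
    ⟨f.repr x.2 1, √(1 - a ^ 2) * e.repr x.1 1 - a * f.repr x.2 0⟩,
    ⟨e.repr x.1 2, -f.repr x.2 2⟩]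

theorem theta_add (a : ℝ) (e : Basis (Fin 3) ℝ V₁) (f : Basis (Fin 3) ℝ V₂) (x y : V₁ × V₂) :
    theta a e f (x + y) = theta a e f x + theta a e f y := by
  ext i
  fin_cases i <;> apply Complex.ext <;> simp [theta] <;> ring

theorem theta_smul (a : ℝ) (e : Basis (Fin 3) ℝ V₁) (f : Basis (Fin 3) ℝ V₂) (t : ℝ)
    (x : V₁ × V₂) : theta a e f (t • x) = (t : ℂ) • theta a e f x := by
  ext i
  fin_cases i <;> apply Complex.ext <;> simp [theta] <;> ring

/-- The multiple by `c` of the wedge product of the three `(1,0)`-forms `theta`. -/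
noncomputable def volumeForm (a : ℝ) (e : Basis (Fin 3) ℝ V₁) (f : Basis (Fin 3) ℝ V₂) (c : ℂ) :
    (V₁ × V₂) [⋀^Fin 3]→ₗ[ℝ] ℂ where
  toFun x := c * Matrix.detRowAlternating fun i => theta a e f (x i)
  map_update_add' x i u v := by
    have h : ∀ w, (fun j => theta a e f (Function.update x i w j)) =
        Function.update (fun j => theta a e f (x j)) i (theta a e f w) := fun w => by
      ext1 j; by_cases hj : j = i
      · subst hj; simp
      · simp [hj]
    simp only [h]
    rw [ theta_add, AlternatingMap.map_update_add, mul_add]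
  map_update_smul' x i t v := by
    have h : ∀ w, (fun j => theta a e f (Function.update x i w j)) =
        Function.update (fun j => theta a e f (x j)) i (theta a e f w) := fun w => by
      ext1 j; by_cases hj : j = i
      · subst hj; simp
      · simp [hj]
    simp only [h]
    rw [theta_smul, AlternatingMap.map_update_smul, smul_eq_mul, Complex.real_smul]
    ring
  map_eq_zero_of_eq' x i j hij hne := by
    rw [AlternatingMap.map_eq_zero_of_eq _ _ (by rw [hij]) hne, mul_zero]

theorem volumeForm_apply (a : ℝ) (e : Basis (Fin 3) ℝ V₁) (f : Basis (Fin 3) ℝ V₂) (c : ℂ)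
    (x y z : V₁ × V₂) : volumeForm a e f c ![x, y, z] =
      c * (Matrix.det (Matrix.of ![theta a e f x, theta a e f y, theta a e f z])) := by
  change c * Matrix.det _ = _
  congr 2
  ext i j; fin_cases i <;> rfl

variable {S : SU3Structure (V₁ × V₂)} {a : ℝ} {e : Basis (Fin 3) ℝ V₁} {f : Basis (Fin 3) ℝ V₂}

theorem eq_of_g_eq (S : SU3Structure (V₁ × V₂)) {u v : V₁ × V₂} (h : ∀ x, S.g x u = S.g x v) :
    u = v := by
  by_contra hne
  have h1 := S.g_pos (u - v) (sub_ne_zero.2 hne)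
  rw [map_sub, h, sub_self] at h1
  exact lt_irrefl _ h1

theorem IsNormalFrame.g_left (h : IsNormalFrame S a e f) (ho : S.SummandsOrthogonal)
    (x : V₁ × V₂) (i : Fin 3) : S.g x (e i, 0) = e.repr x.1 i := by
  have h1 : x = ∑ j, e.repr x.1 j • ((e j, 0) : V₁ × V₂) + (0, x.2) := by
    refine Prod.ext ?_ ?_
    · simp [Prod.fst_sum, e.sum_repr]
    · simp [Prod.snd_sum]
  conv_lhs => rw [h1]
  rw [map_add, LinearMap.add_apply, S.g_symm (0, x.2), ho, map_sum, LinearMap.sum_apply]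
  simp only [map_smul, LinearMap.smul_apply, h.1, smul_eq_mul, mul_ite, mul_one, mul_zero,
    Finset.sum_ite_eq', Finset.mem_univ, if_true, add_zero]

theorem IsNormalFrame.g_right (h : IsNormalFrame S a e f) (ho : S.SummandsOrthogonal)
    (x : V₁ × V₂) (i : Fin 3) : S.g x (0, f i) = f.repr x.2 i := by
  have h1 : x = ∑ j, f.repr x.2 j • ((0, f j) : V₁ × V₂) + (x.1, 0) := by
    refine Prod.ext ?_ ?_
    · simp [Prod.fst_sum]
    · simp [Prod.snd_sum, f.sum_repr]
  conv_lhs => rw [h1]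
  rw [map_add, LinearMap.add_apply, ho, map_sum, LinearMap.sum_apply]
  simp only [map_smul, LinearMap.smul_apply, h.2.1, smul_eq_mul, mul_ite, mul_one, mul_zero,
    Finset.sum_ite_eq', Finset.mem_univ, if_true, add_zero]

theorem IsNormalFrame.J_e2 (h : IsNormalFrame S a e f) (ho : S.SummandsOrthogonal) :
    S.J (e 2, 0) = -(0, f 2) := by
  refine eq_of_g_eq S fun x => ?_
  rw [← S.ω_eq, h.2.2, map_neg, h.g_right ho]
  simp

theorem IsNormalFrame.J_e0 (h : IsNormalFrame S a e f) (ho : S.SummandsOrthogonal) :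
    S.J (e 0, 0) = -a • (e 1, 0) - √(1 - a ^ 2) • (0, f 0) := by
  refine eq_of_g_eq S fun x => ?_
  rw [← S.ω_eq, h.2.2, map_sub, map_smul, map_smul, h.g_right ho, h.g_left ho]
  simp
  ring

theorem IsNormalFrame.J_f1 (h : IsNormalFrame S a e f) (ho : S.SummandsOrthogonal) :
    S.J (0, f 1) = √(1 - a ^ 2) • (e 1, 0) - a • (0, f 0) := by
  refine eq_of_g_eq S fun x => ?_
  rw [← S.ω_eq, h.2.2, map_sub, map_smul, map_smul, h.g_right ho, h.g_left ho]
  simp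

/-- The vectors e 0, f 1, e 2 form a complex basis for J throughout the range of a, including a = 0
and a = ±1, and `theta` gives the complex coordinates in it. -/
theorem IsNormalFrame.eq_sum (h : IsNormalFrame S a e f) (ho : S.SummandsOrthogonal)
    (ha : a ^ 2 ≤ 1) (x : V₁ × V₂) :
    x = (theta a e f x 0).re • (e 0, 0) + (theta a e f x 0).im • S.J (e 0, 0)
      + ((theta a e f x 1).re • (0, f 1) + (theta a e f x 1).im • S.J (0, f 1))
      + ((theta a e f x 2).re • (e 2, 0) + (theta a e f x 2).im • S.J (e 2, 0)) := by
  have hs : √(1 - a ^ 2) * √(1 - a ^ 2) = 1 - a ^ 2 := Real.mul_self_sqrt (by linarith)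
  rw [h.J_e2 ho, h.J_e0 ho, h.J_f1 ho]
  refine Prod.ext (e.repr.injective ?_) (f.repr.injective ?_)
  · ext i; fin_cases i <;> simp [theta]
    linear_combination (-e.repr x.1 1) * hs
  · ext i; fin_cases i <;> simp [theta]
    linear_combination (-f.repr x.2 0) * hs

/-- A (3,0)-form is complex trilinear and alternating on a complex space of dimension three, hence a
multiple of the determinant; the factor is its value on the complex basis. -/
theorem IsNormalFrame.psi_eq (h : IsNormalFrame S a e f) (ho : S.SummandsOrthogonal)
    (ha : a ^ 2 ≤ 1) (x y z : V₁ × V₂) :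
    S.Ψ ![x, y, z] = volumeForm a e f (S.Ψ ![(e 0, 0), (0, f 1), (e 2, 0)]) ![x, y, z] := by
  have cyc : ∀ u v w, S.Ψ ![u, v, w] = S.Ψ ![v, w, u] := fun u v w => by
    rw [← one_smul ℤˣ (S.Ψ ![u, v, w])]
    rw [show (1 : ℤˣ) = Equiv.Perm.sign (finRotate 3) by decide, ← S.Ψ.map_perm]
    congr 1; ext1 i; fin_cases i <;> rfl
  have swp : ∀ u v w, S.Ψ ![u, v, w] = - S.Ψ ![v, u, w] := fun u v w => by
    rw [← S.Ψ.map_swap ![v, u, w] (show (0 : Fin 3) ≠ 1 by decide)]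
    congr 1; ext1 i; fin_cases i <;> rfl
  have dbl : ∀ u w, S.Ψ ![u, u, w] = 0 := fun u w =>
    S.Ψ.map_eq_zero_of_eq _ (show ![u, u, w] 0 = ![u, u, w] 1 from rfl) (by decide)
  have expand : ∀ u v w, S.Ψ ![u, v, w] = theta a e f u 0 * S.Ψ ![(e 0, 0), v, w]
      + theta a e f u 1 * S.Ψ ![(0, f 1), v, w] + theta a e f u 2 * S.Ψ ![(e 2, 0), v, w] := by
    intro u v w
    -- Type (3,0) turns the real coefficients of p and J p into one complex coefficient.
    have hJ : ∀ p : V₁ × V₂, ∀ t : ℂ, (t.re • S.Ψ ![p, v, w] + t.im • S.Ψ ![S.J p, v, w])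
        = t * S.Ψ ![p, v, w] := fun p t => by
      rw [S.Ψ_type, Complex.real_smul, Complex.real_smul]
      conv_rhs => rw [← Complex.re_add_im t]
      ring
    conv_lhs => rw [h.eq_sum ho ha u]
    have ladd : ∀ p q : V₁ × V₂, S.Ψ ![p + q, v, w] = S.Ψ ![p, v, w] + S.Ψ ![q, v, w] :=
      fun p q => S.Ψ.map_vecCons_add _ _ _
    have lsmul : ∀ (t : ℝ) (p : V₁ × V₂), S.Ψ ![t • p, v, w] = t • S.Ψ ![p, v, w] :=
      fun t p => S.Ψ.map_vecCons_smul _ _ _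
    simp only [ladd, lsmul]
    rw [hJ, hJ, hJ]
  have expand₂ : ∀ u v w, S.Ψ ![u, v, w] = theta a e f v 0 * S.Ψ ![u, (e 0, 0), w]
      + theta a e f v 1 * S.Ψ ![u, (0, f 1), w] + theta a e f v 2 * S.Ψ ![u, (e 2, 0), w] := by
    intro u v w
    rw [cyc u v, expand v, cyc u (e 0, 0), cyc u (0, f 1), cyc u (e 2, 0)]
  have expand₃ : ∀ u v w, S.Ψ ![u, v, w] = theta a e f w 0 * S.Ψ ![u, v, (e 0, 0)]
      + theta a e f w 1 * S.Ψ ![u, v, (0, f 1)] + theta a e f w 2 * S.Ψ ![u, v, (e 2, 0)] := by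
    intro u v w
    rw [← cyc w u v, expand w, cyc _ u v, cyc _ u v, cyc _ u v]
  have dbl₂ : ∀ u w, S.Ψ ![u, w, w] = 0 := fun u w => by rw [cyc, dbl]
  have dbl₃ : ∀ u w, S.Ψ ![u, w, u] = 0 := fun u w => by rw [cyc, dbl₂]
  rw [expand x, expand₂ _ y, expand₂ _ y, expand₂ _ y]
  simp only [dbl, expand₃ _ _ z, dbl₂, dbl₃]
  rw [swp (0, f 1) (e 0, 0), cyc (e 2, 0) (e 0, 0), swp (e 2, 0) (0, f 1), cyc (0, f 1) (e 2, 0),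
    cyc (e 2, 0) (e 0, 0), cyc (e 0, 0) (e 2, 0), swp (e 2, 0) (0, f 1), cyc (0, f 1) (e 2, 0),
    cyc (e 2, 0) (e 0, 0), volumeForm_apply, Matrix.det_fin_three]
  simp only [Matrix.of_apply, Matrix.cons_val]
  ring

theorem IsNormalFrame.rePsi_eq (h : IsNormalFrame S a e f) (ho : S.SummandsOrthogonal)
    (ha : a ^ 2 ≤ 1) (x y z : V₁ × V₂) :
    S.rePsi ![x, y, z] =
      (volumeForm a e f (S.Ψ ![(e 0, 0), (0, f 1), (e 2, 0)]) ![x, y, z]).re := by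
  rw [← h.psi_eq ho ha]; rfl

end Frames

/-- The basis `e` has the structure matrix `A`: the `l`-th column of `A` lists the coordinates of
`[e (l + 1), e (l + 2)]`, indices modulo three. -/
def HasStructure {L : Type*} [LieRing L] [LieAlgebra ℝ L] (e : Basis (Fin 3) ℝ L)
    (A : Matrix (Fin 3) (Fin 3) ℝ) : Prop :=
  ∀ l, ⁅e (l + 1), e (l + 2)⁆ = ∑ k, A k l • e k

/-! ### Brackets read off from the structure matrix. -/

section
variable {L : Type*} [LieRing L] [LieAlgebra ℝ L] {e : Basis (Fin 3) ℝ L}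
    {A : Matrix (Fin 3) (Fin 3) ℝ}

theorem exists_hasStructure (e : Basis (Fin 3) ℝ L) : ∃ A, HasStructure e A :=
  ⟨fun k l => e.repr ⁅e (l + 1), e (l + 2)⁆ k, fun _ => (e.sum_repr _).symm⟩

theorem HasStructure.lie_one_two (h : HasStructure e A) :
    ⁅e 1, e 2⁆ = A 0 0 • e 0 + A 1 0 • e 1 + A 2 0 • e 2 := by
  simpa [Fin.sum_univ_three] using h 0

theorem HasStructure.lie_two_zero (h : HasStructure e A) :
    ⁅e 2, e 0⁆ = A 0 1 • e 0 + A 1 1 • e 1 + A 2 1 • e 2 := by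
  simpa [Fin.sum_univ_three] using h 1

theorem HasStructure.lie_zero_one (h : HasStructure e A) :
    ⁅e 0, e 1⁆ = A 0 2 • e 0 + A 1 2 • e 1 + A 2 2 • e 2 := by
  simpa [Fin.sum_univ_three] using h 2

theorem HasStructure.lie_zero_two (h : HasStructure e A) :
    ⁅e 0, e 2⁆ = -(A 0 1 • e 0 + A 1 1 • e 1 + A 2 1 • e 2) := by
  rw [← h.lie_two_zero, lie_skew]

end

/-! ### Closedness as linear equations in the structure matrices. -/

section Product
variable {L₁ L₂ : Type*} [LieRing L₁] [LieAlgebra ℝ L₁] [LieRing L₂] [LieAlgebra ℝ L₂]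

/-- The basis of the product formed by bases of the two summands. -/
noncomputable def prodBasis (e : Basis (Fin 3) ℝ L₁) (f : Basis (Fin 3) ℝ L₂) :
    Basis (Fin 6) ℝ (L₁ × L₂) :=
  (e.prod f).reindex (finSumFinEquiv (m := 3) (n := 3))

theorem prodBasis_apply (e : Basis (Fin 3) ℝ L₁) (f : Basis (Fin 3) ℝ L₂) :
    ⇑(prodBasis e f) = ![(e 0, 0), (e 1, 0), (e 2, 0), (0, f 0), (0, f 1), (0, f 2)] := by
  ext1 i
  rw [prodBasis, Basis.reindex_apply]
  fin_cases i <;> refine Prod.ext ?_ ?_ <;> simp [finSumFinEquiv, Fin.addCases, Basis.prod]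

variable {S : SU3Structure (L₁ × L₂)} {a : ℝ} {e : Basis (Fin 3) ℝ L₁} {f : Basis (Fin 3) ℝ L₂}
  {A B : Matrix (Fin 3) (Fin 3) ℝ}

theorem forall_fin_six_four {P : Fin 6 → Fin 6 → Fin 6 → Fin 6 → Prop} :
    (∀ i j k l, i < j → j < k → k < l → P i j k l) ↔
      P 0 1 2 3 ∧ P 0 1 2 4 ∧ P 0 1 2 5 ∧ P 0 1 3 4 ∧ P 0 1 3 5 ∧ P 0 1 4 5 ∧ P 0 2 3 4 ∧
      P 0 2 3 5 ∧ P 0 2 4 5 ∧ P 0 3 4 5 ∧ P 1 2 3 4 ∧ P 1 2 3 5 ∧ P 1 2 4 5 ∧ P 1 3 4 5 ∧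
      P 2 3 4 5 := by
  have h : ∀ i j k l : Fin 6, i < j → j < k → k < l → (i, j, k, l) ∈
      ([(0,1,2,3), (0,1,2,4), (0,1,2,5), (0,1,3,4), (0,1,3,5), (0,1,4,5), (0,2,3,4), (0,2,3,5),
        (0,2,4,5), (0,3,4,5), (1,2,3,4), (1,2,3,5), (1,2,4,5), (1,3,4,5), (2,3,4,5)] :
        List (Fin 6 × Fin 6 × Fin 6 × Fin 6)) := by decide
  constructor
  · intro H
    refine ⟨?_, ?_, ?_, ?_, ?_, ?_, ?_, ?_, ?_, ?_, ?_, ?_, ?_, ?_, ?_⟩ <;>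
      exact H _ _ _ _ (by decide) (by decide) (by decide)
  · intro H i j k l hij hjk hkl
    have := h i j k l hij hjk hkl
    simp only [List.mem_cons, Prod.mk.injEq, List.not_mem_nil, or_false] at this
    rcases this with h | h | h | h | h | h | h | h | h | h | h | h | h | h | h <;>
      (obtain ⟨rfl, rfl, rfl, rfl⟩ := h; simp only [H])

theorem forall_fin_six_five {P : Fin 6 → Fin 6 → Fin 6 → Fin 6 → Fin 6 → Prop} :
    (∀ i j k l m, i < j → j < k → k < l → l < m → P i j k l m) ↔
      P 0 1 2 3 4 ∧ P 0 1 2 3 5 ∧ P 0 1 2 4 5 ∧ P 0 1 3 4 5 ∧ P 0 2 3 4 5 ∧ P 1 2 3 4 5 := by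
  have h : ∀ i j k l m : Fin 6, i < j → j < k → k < l → l < m → (i, j, k, l, m) ∈
      ([(0,1,2,3,4), (0,1,2,3,5), (0,1,2,4,5), (0,1,3,4,5), (0,2,3,4,5), (1,2,3,4,5)] :
        List (Fin 6 × Fin 6 × Fin 6 × Fin 6 × Fin 6)) := by decide
  constructor
  · intro H
    refine ⟨?_, ?_, ?_, ?_, ?_, ?_⟩ <;>
      exact H _ _ _ _ _ (by decide) (by decide) (by decide) (by decide)
  · intro H i j k l m hij hjk hkl hlm
    have := h i j k l m hij hjk hkl hlm
    simp only [List.mem_cons, Prod.mk.injEq, List.not_mem_nil, or_false] at this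
    rcases this with h | h | h | h | h | h <;>
      (obtain ⟨rfl, rfl, rfl, rfl, rfl⟩ := h; simp only [H])

set_option maxHeartbeats 1000000 in
-- The fifteen equations are the values of d(Re Ψ) on the increasing quadruples of the basis (e, f),
-- in lexicographic order.
theorem isClosedForm_rePsi_iff (h : IsNormalFrame S a e f) (ho : S.SummandsOrthogonal)
    (ha : a ^ 2 ≤ 1) (hA : HasStructure e A) (hB : HasStructure f B) {α β : ℝ}
    (hc : S.Ψ ![(e 0, 0), (0, f 1), (e 2, 0)] = ⟨α, β⟩) :
    IsClosedForm (n := 2) S.rePsi ↔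
      α * (A 2 1 - A 1 2) + β * a * (A 0 2 - A 2 0) = 0 ∧
      β * a * (A 1 2 - A 2 1) + α * (A 0 2 - A 2 0) = 0 ∧
      α * √(1 - a ^ 2) * (A 1 0 - A 0 1) = 0 ∧
      √(1 - a ^ 2) * (β * A 2 2 + α * B 2 2) = 0 ∧
      β * A 1 2 + α * a * A 0 2 + α * √(1 - a ^ 2) * B 2 1 = 0 ∧
      -(β * A 0 2) + α * a * A 1 2 - α * √(1 - a ^ 2) * B 2 0 = 0 ∧
      β * √(1 - a ^ 2) * A 2 1 + α * B 1 2 + β * a * B 0 2 = 0 ∧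
      β * A 1 1 + α * a * A 0 1 + α * B 1 1 + β * a * B 0 1 = 0 ∧
      β * A 0 1 - α * a * A 1 1 + α * B 1 0 + β * a * B 0 0 = 0 ∧
      β * (B 1 2 - B 2 1) - α * a * (B 0 2 - B 2 0) = 0 ∧
      -(β * √(1 - a ^ 2) * A 2 0) - α * B 0 2 + β * a * B 1 2 = 0 ∧
      β * A 1 0 + α * a * A 0 0 + α * B 0 1 - β * a * B 1 1 = 0 ∧
      -(β * A 0 0) + α * a * A 1 0 - α * B 0 0 + β * a * B 1 0 = 0 ∧
      β * (B 2 0 - B 0 2) + α * a * (B 2 1 - B 1 2) = 0 ∧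
      β * √(1 - a ^ 2) * (B 0 1 - B 1 0) = 0 := by
  rw [isClosedForm_three_iff (prodBasis e f), forall_fin_six_four]
  have hs : √(1 - a ^ 2) * √(1 - a ^ 2) = 1 - a ^ 2 := Real.mul_self_sqrt (by linarith)
  simp only [ceDiff_three, h.rePsi_eq ho ha, hc, volumeForm_apply, prodBasis_apply,
    Matrix.cons_val, LieAlgebra.Prod.bracket_apply, lie_zero, zero_lie, hA.lie_one_two,
    hA.lie_zero_one, hA.lie_zero_two, hB.lie_one_two, hB.lie_zero_one, hB.lie_zero_two]
  simp only [theta, Matrix.det_fin_three]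
  -- Only s² = 1 - a² is used about the square root, so the rest is polynomial algebra.
  generalize √(1 - a ^ 2) = s at *
  simp [-mul_eq_zero]
  clear hA hB hc h
  iterate 14 refine and_congr (by grind) ?_
  grind

set_option maxHeartbeats 1000000 in
theorem isClosedForm_wedge_iff (h : IsNormalFrame S a e f)
    (ha : a ^ 2 ≤ 1) (hA : HasStructure e A) (hB : HasStructure f B) :
    IsClosedForm (n := 3) (wedge (p := 2) (q := 2) S.ω S.ω) ↔
      A 0 1 - A 1 0 + a * B 2 2 = 0 ∧
      √(1 - a ^ 2) * (A 0 2 - A 2 0) - a * B 2 1 = 0 ∧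
      √(1 - a ^ 2) * (A 1 2 - A 2 1) + a * B 2 0 = 0 ∧
      a * A 2 2 + B 0 1 - B 1 0 = 0 ∧
      -(a * A 2 1) + √(1 - a ^ 2) * (B 0 2 - B 2 0) = 0 ∧
      a * A 2 0 + √(1 - a ^ 2) * (B 1 2 - B 2 1) = 0 := by
  rw [isClosedForm_four_iff (prodBasis e f), forall_fin_six_five]
  have hs : √(1 - a ^ 2) * √(1 - a ^ 2) = 1 - a ^ 2 := Real.mul_self_sqrt (by linarith)
  simp only [ceDiff_four, wedge_two_two, h.2.2, prodBasis_apply,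
    Matrix.cons_val, LieAlgebra.Prod.bracket_apply, lie_zero, zero_lie, hA.lie_one_two,
    hA.lie_zero_one, hA.lie_zero_two, hB.lie_one_two, hB.lie_zero_one, hB.lie_zero_two]
  generalize √(1 - a ^ 2) = s at *
  simp [-mul_eq_zero]
  clear hA hB h
  iterate 5 refine and_congr (by grind) ?_
  grind
end Product

/-! ### The SU(3)-structure defined by a pair of bases. -/

section Construction

variable {V₁ V₂ : Type*} [AddCommGroup V₁] [Module ℝ V₁] [AddCommGroup V₂] [Module ℝ V₂]
  (a : ℝ) (e : Basis (Fin 3) ℝ V₁) (f : Basis (Fin 3) ℝ V₂)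

/-- The scalar product for which the union of two bases of the summands is orthonormal. -/
noncomputable def frameMetric : LinearMap.BilinForm ℝ (V₁ × V₂) :=
  LinearMap.mk₂ ℝ (fun x y => ∑ i, e.repr x.1 i * e.repr y.1 i + ∑ i, f.repr x.2 i * f.repr y.2 i)
    (fun x y z => by simp [Fin.sum_univ_three]; ring)
    (fun t x y => by simp [Fin.sum_univ_three]; ring)
    (fun x y z => by simp [Fin.sum_univ_three]; ring)
    (fun t x y => by simp [Fin.sum_univ_three]; ring)

theorem frameMetric_apply (x y : V₁ × V₂) : frameMetric e f x y =
    e.repr x.1 0 * e.repr y.1 0 + e.repr x.1 1 * e.repr y.1 1 + e.repr x.1 2 * e.repr y.1 2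
      + (f.repr x.2 0 * f.repr y.2 0 + f.repr x.2 1 * f.repr y.2 1
        + f.repr x.2 2 * f.repr y.2 2) := by
  simp [frameMetric, Fin.sum_univ_three]

/-- The complex structure of the normal form with parameter `a`. -/
noncomputable def frameJ : (V₁ × V₂) →ₗ[ℝ] (V₁ × V₂) where
  toFun x :=
    ((a * e.repr x.1 1 + √(1 - a ^ 2) * f.repr x.2 0) • e 0
        + (√(1 - a ^ 2) * f.repr x.2 1 - a * e.repr x.1 0) • e 1 + f.repr x.2 2 • e 2,
      (-√(1 - a ^ 2) * e.repr x.1 0 - a * f.repr x.2 1) • f 0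
        + (a * f.repr x.2 0 - √(1 - a ^ 2) * e.repr x.1 1) • f 1 - e.repr x.1 2 • f 2)
  map_add' x y := by
    simp only [Prod.fst_add, Prod.snd_add, map_add, Finsupp.add_apply, Prod.mk_add_mk]
    refine Prod.ext ?_ ?_ <;> simp only <;> module
  map_smul' t x := by
    simp only [Prod.smul_fst, Prod.smul_snd, map_smul, Finsupp.smul_apply, Prod.smul_mk,
      smul_eq_mul, RingHom.id_apply]
    refine Prod.ext ?_ ?_ <;> simp only <;> module

theorem repr_frameJ_fst (x : V₁ × V₂) : ⇑(e.repr (frameJ a e f x).1) =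
    ![a * e.repr x.1 1 + √(1 - a ^ 2) * f.repr x.2 0,
      √(1 - a ^ 2) * f.repr x.2 1 - a * e.repr x.1 0, f.repr x.2 2] := by
  ext i; fin_cases i <;> simp [frameJ]

theorem repr_frameJ_snd (x : V₁ × V₂) : ⇑(f.repr (frameJ a e f x).2) =
    ![-√(1 - a ^ 2) * e.repr x.1 0 - a * f.repr x.2 1,
      a * f.repr x.2 0 - √(1 - a ^ 2) * e.repr x.1 1, -e.repr x.1 2] := by
  ext i; fin_cases i <;> simp [frameJ]

/-- The fundamental two-form of the normal form with parameter `a`. -/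
noncomputable def frameOmega : (V₁ × V₂) [⋀^Fin 2]→ₗ[ℝ] ℝ where
  toFun x := frameMetric e f (x 0) (frameJ a e f (x 1))
  map_update_add' x i u v := by
    fin_cases i <;> simp
  map_update_smul' x i t u := by
    fin_cases i <;> simp
  map_eq_zero_of_eq' x i j hij hne := by
    have h : x 0 = x 1 := by
      fin_cases i <;> fin_cases j <;> simp_all
    rw [h, frameMetric_apply, repr_frameJ_fst, repr_frameJ_snd]
    simp only [Matrix.cons_val]
    ring

theorem theta_frameJ (x : V₁ × V₂) (ha : a ^ 2 ≤ 1) :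
    theta a e f (frameJ a e f x) = Complex.I • theta a e f x := by
  have hs : √(1 - a ^ 2) * √(1 - a ^ 2) = 1 - a ^ 2 := Real.mul_self_sqrt (by linarith)
  ext i
  fin_cases i <;> apply Complex.ext <;>
    simp [theta, repr_frameJ_fst, repr_frameJ_snd] <;> grind

/-- The `SU(3)`-structure in normal form with respect to two bases of the summands. -/
noncomputable def frameStructure (ha : a ^ 2 ≤ 1) (c : ℂ) (hc : c ≠ 0) :
    SU3Structure (V₁ × V₂) where
  g := frameMetric e f
  g_symm x y := by simp only [frameMetric_apply]; ring
  g_pos x hx := by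
    rw [frameMetric_apply]
    by_contra! h
    refine hx (Prod.ext (e.repr.injective ?_) (f.repr.injective ?_)) <;>
    · ext i
      fin_cases i <;> simp <;>
        nlinarith [sq_nonneg (e.repr x.1 0), sq_nonneg (e.repr x.1 1), sq_nonneg (e.repr x.1 2),
          sq_nonneg (f.repr x.2 0), sq_nonneg (f.repr x.2 1), sq_nonneg (f.repr x.2 2)]
  J := frameJ a e f
  J_sq x := by
    have hs : √(1 - a ^ 2) * √(1 - a ^ 2) = 1 - a ^ 2 := Real.mul_self_sqrt (by linarith)
    refine Prod.ext (e.repr.injective ?_) (f.repr.injective ?_) <;>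
    · ext i
      fin_cases i <;> simp [repr_frameJ_fst, repr_frameJ_snd] <;> grind
  J_orthogonal x y := by
    have hs : √(1 - a ^ 2) * √(1 - a ^ 2) = 1 - a ^ 2 := Real.mul_self_sqrt (by linarith)
    simp only [frameMetric_apply, repr_frameJ_fst, repr_frameJ_snd, Matrix.cons_val]
    generalize √(1 - a ^ 2) = s at *
    grind
  ω := frameOmega a e f
  ω_eq x y := rfl
  Ψ := volumeForm a e f c
  Ψ_type x y z := by
    rw [volumeForm_apply, volumeForm_apply, theta_frameJ a e f x ha, Matrix.det_fin_three,
      Matrix.det_fin_three]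
    simp only [Matrix.of_apply, Matrix.cons_val, Pi.smul_apply, smul_eq_mul]
    ring
  Ψ_ne_zero h := by
    have := volumeForm_apply a e f c (e 0, 0) (0, f 1) (e 2, 0)
    rw [h] at this
    simp [Matrix.det_fin_three, theta, Complex.ext_iff] at this
    exact hc (Complex.ext this.1 this.2)

variable {a e f}

theorem isNormalFrame_frameStructure (ha : a ^ 2 ≤ 1) {c : ℂ} (hc : c ≠ 0) :
    IsNormalFrame (frameStructure a e f ha c hc) a e f := by
  refine ⟨fun i j => ?_, fun i j => ?_, fun u v => ?_⟩
  · change frameMetric e f _ _ = _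
    rw [frameMetric_apply]
    fin_cases i <;> fin_cases j <;> simp
  · change frameMetric e f _ _ = _
    rw [frameMetric_apply]
    fin_cases i <;> fin_cases j <;> simp
  · change frameMetric e f u (frameJ a e f v) = _
    rw [frameMetric_apply, repr_frameJ_fst, repr_frameJ_snd]
    simp only [Matrix.cons_val]
    ring

theorem summandsOrthogonal_frameStructure (ha : a ^ 2 ≤ 1) {c : ℂ} (hc : c ≠ 0) :
    (frameStructure a e f ha c hc).SummandsOrthogonal := by
  intro x y
  change frameMetric e f _ _ = _
  rw [frameMetric_apply]
  simp

theorem frameStructure_psi (ha : a ^ 2 ≤ 1) {c : ℂ} (hc : c ≠ 0) :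
    (frameStructure a e f ha c hc).Ψ ![(e 0, 0), (0, f 1), (e 2, 0)] = c := by
  change volumeForm a e f c _ = _
  rw [volumeForm_apply, Matrix.det_fin_three]
  simp [theta, Complex.ext_iff]

end Construction

/-- The equations on structure matrices that express half-flatness in a normal frame. -/
def HalfFlatEquations (A B : Matrix (Fin 3) (Fin 3) ℝ) (a α β : ℝ) : Prop :=
  (A 0 1 - A 1 0 + a * B 2 2 = 0 ∧
      √(1 - a ^ 2) * (A 0 2 - A 2 0) - a * B 2 1 = 0 ∧
      √(1 - a ^ 2) * (A 1 2 - A 2 1) + a * B 2 0 = 0 ∧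
      a * A 2 2 + B 0 1 - B 1 0 = 0 ∧
      -(a * A 2 1) + √(1 - a ^ 2) * (B 0 2 - B 2 0) = 0 ∧
      a * A 2 0 + √(1 - a ^ 2) * (B 1 2 - B 2 1) = 0) ∧
    α * (A 2 1 - A 1 2) + β * a * (A 0 2 - A 2 0) = 0 ∧
      β * a * (A 1 2 - A 2 1) + α * (A 0 2 - A 2 0) = 0 ∧
      α * √(1 - a ^ 2) * (A 1 0 - A 0 1) = 0 ∧
      √(1 - a ^ 2) * (β * A 2 2 + α * B 2 2) = 0 ∧
      β * A 1 2 + α * a * A 0 2 + α * √(1 - a ^ 2) * B 2 1 = 0 ∧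
      -(β * A 0 2) + α * a * A 1 2 - α * √(1 - a ^ 2) * B 2 0 = 0 ∧
      β * √(1 - a ^ 2) * A 2 1 + α * B 1 2 + β * a * B 0 2 = 0 ∧
      β * A 1 1 + α * a * A 0 1 + α * B 1 1 + β * a * B 0 1 = 0 ∧
      β * A 0 1 - α * a * A 1 1 + α * B 1 0 + β * a * B 0 0 = 0 ∧
      β * (B 1 2 - B 2 1) - α * a * (B 0 2 - B 2 0) = 0 ∧
      -(β * √(1 - a ^ 2) * A 2 0) - α * B 0 2 + β * a * B 1 2 = 0 ∧
      β * A 1 0 + α * a * A 0 0 + α * B 0 1 - β * a * B 1 1 = 0 ∧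
      -(β * A 0 0) + α * a * A 1 0 - α * B 0 0 + β * a * B 1 0 = 0 ∧
      β * (B 2 0 - B 0 2) + α * a * (B 2 1 - B 1 2) = 0 ∧
      β * √(1 - a ^ 2) * (B 0 1 - B 1 0) = 0

/-- Exchanging the two summands together with α and β turns each of the 21 equations into plus or
minus one of them, so arguments about one summand transfer to the other. -/
theorem HalfFlatEquations.symm {A B : Matrix (Fin 3) (Fin 3) ℝ} {a α β : ℝ}
    (h : HalfFlatEquations A B a α β) : HalfFlatEquations B A a β α := by
  unfold HalfFlatEquations at *
  generalize √(1 - a ^ 2) = s at *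
  obtain ⟨⟨h1, h2, h3, h4, h5, h6⟩, k1, k2, k3, k4, k5, k6, k7, k8, k9, k10, k11, k12, k13, k14,
    k15⟩ := h
  refine ⟨⟨?_, ?_, ?_, ?_, ?_, ?_⟩, ?_, ?_, ?_, ?_, ?_, ?_, ?_, ?_, ?_, ?_, ?_, ?_, ?_, ?_, ?_⟩
  all_goals first
    | linear_combination h1 | linear_combination h2 | linear_combination h3
    | linear_combination h4 | linear_combination h5 | linear_combination h6
    | linear_combination k1 | linear_combination k2 | linear_combination k3
    | linear_combination k4 | linear_combination k5 | linear_combination k6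
    | linear_combination k7 | linear_combination k8 | linear_combination k9
    | linear_combination k10 | linear_combination k11 | linear_combination k12
    | linear_combination k13 | linear_combination k14 | linear_combination k15
    | linear_combination -h1 | linear_combination -h2 | linear_combination -h3
    | linear_combination -h4 | linear_combination -h5 | linear_combination -h6
    | linear_combination -k1 | linear_combination -k2 | linear_combination -k3
    | linear_combination -k4 | linear_combination -k5 | linear_combination -k6
    | linear_combination -k7 | linear_combination -k8 | linear_combination -k9
    | linear_combination -k10 | linear_combination -k11 | linear_combination -k12
    | linear_combination -k13 | linear_combination -k14 | linear_combination -k15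

/-! ### Reduction of half-flat structures to solutions of the equations. -/

section Product
variable {L₁ L₂ : Type*} [LieRing L₁] [LieAlgebra ℝ L₁] [LieRing L₂] [LieAlgebra ℝ L₂]

theorem IsNormalFrame.isHalfFlat_iff {S : SU3Structure (L₁ × L₂)} {a : ℝ}
    {e : Basis (Fin 3) ℝ L₁} {f : Basis (Fin 3) ℝ L₂} {A B : Matrix (Fin 3) (Fin 3) ℝ}
    (h : IsNormalFrame S a e f) (ho : S.SummandsOrthogonal)
    (ha : a ^ 2 ≤ 1) (hA : HasStructure e A) (hB : HasStructure f B) {α β : ℝ}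
    (hc : S.Ψ ![(e 0, 0), (0, f 1), (e 2, 0)] = ⟨α, β⟩) :
    S.IsHalfFlat ↔ HalfFlatEquations A B a α β :=
  and_congr (isClosedForm_wedge_iff h ha hA hB) (isClosedForm_rePsi_iff h ho ha hA hB hc)

theorem IsNormalFrame.psi_ne_zero {S : SU3Structure (L₁ × L₂)} {a : ℝ}
    {e : Basis (Fin 3) ℝ L₁} {f : Basis (Fin 3) ℝ L₂}
    (h : IsNormalFrame S a e f) (ho : S.SummandsOrthogonal) (ha : a ^ 2 ≤ 1) :
    S.Ψ ![(e 0, 0), (0, f 1), (e 2, 0)] ≠ 0 := by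
  intro h0
  refine S.Ψ_ne_zero (AlternatingMap.ext fun x => ?_)
  have : x = ![x 0, x 1, x 2] := by ext1 i; fin_cases i <;> rfl
  rw [this, h.psi_eq ho ha, h0, volumeForm_apply, zero_mul]; rfl

/-- The Lie algebra has a basis with the given structure matrix. -/
def Admits (L : Type*) [LieRing L] [LieAlgebra ℝ L] (A : Matrix (Fin 3) (Fin 3) ℝ) : Prop :=
  ∃ e : Basis (Fin 3) ℝ L, HasStructure e A

/-- Once a frame is fixed, the only remaining freedom in the structure is the number c = α + iβ,
which is non-zero exactly when Ψ is. -/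
theorem exists_halfFlat_iff {a : ℝ} (ha : a ^ 2 ≤ 1) :
    (∃ S : SU3Structure (L₁ × L₂), S.IsHalfFlat ∧ S.SummandsOrthogonal ∧ S.HasNormalForm a) ↔
      ∃ A B α β, Admits L₁ A ∧ Admits L₂ B ∧ (α ≠ 0 ∨ β ≠ 0) ∧ HalfFlatEquations A B a α β := by
  constructor
  · rintro ⟨S, hS, ho, e, f, hn⟩
    replace hn : IsNormalFrame S a e f := hn
    obtain ⟨A, hA⟩ := exists_hasStructure e
    obtain ⟨B, hB⟩ := exists_hasStructure f
    refine ⟨A, B, (S.Ψ ![(e 0, 0), (0, f 1), (e 2, 0)]).re,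
      (S.Ψ ![(e 0, 0), (0, f 1), (e 2, 0)]).im, ⟨e, hA⟩, ⟨f, hB⟩, ?_,
      (hn.isHalfFlat_iff ho ha hA hB rfl).1 hS⟩
    by_contra! h
    exact hn.psi_ne_zero ho ha (Complex.ext h.1 h.2)
  · rintro ⟨A, B, α, β, ⟨e, hA⟩, ⟨f, hB⟩, hne, h⟩
    have hc : (⟨α, β⟩ : ℂ) ≠ 0 := fun h0 => by simp [Complex.ext_iff] at h0; tauto
    exact ⟨frameStructure a e f ha _ hc,
      ((isNormalFrame_frameStructure ha hc).isHalfFlat_iff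
        (summandsOrthogonal_frameStructure ha hc) ha hA hB (frameStructure_psi ha hc)).2 h,
      summandsOrthogonal_frameStructure ha hc, e, f, isNormalFrame_frameStructure ha hc⟩

end Product

/-! ### Lie algebra properties in terms of structure matrices. -/

section Structure

variable {L M : Type*} [LieRing L] [LieAlgebra ℝ L] [LieRing M] [LieAlgebra ℝ M]
  {A : Matrix (Fin 3) (Fin 3) ℝ}

theorem iso_of_admits (hL : Admits L A) (hM : Admits M A) : Iso L M := by
  obtain ⟨e, he⟩ := hL
  obtain ⟨f, hf⟩ := hM
  let φ : L ≃ₗ[ℝ] M := e.equiv f (Equiv.refl _)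
  have hφ : ∀ i, φ (e i) = f i := fun i => by simp [φ]
  have key : LinearMap.compr₂ (LieModule.toEnd ℝ L L : L →ₗ[ℝ] L →ₗ[ℝ] L) φ.toLinearMap =
      LinearMap.compl₁₂ (LieModule.toEnd ℝ M M : M →ₗ[ℝ] M →ₗ[ℝ] M) φ.toLinearMap
        φ.toLinearMap := by
    refine e.ext fun i => e.ext fun j => ?_
    change φ ⁅e i, e j⁆ = ⁅φ (e i), φ (e j)⁆
    rw [hφ, hφ]
    have h10 : ⁅e 1, e 0⁆ = -⁅e 0, e 1⁆ := (lie_skew _ _).symm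
    have h21 : ⁅e 2, e 1⁆ = -⁅e 1, e 2⁆ := (lie_skew _ _).symm
    have k10 : ⁅f 1, f 0⁆ = -⁅f 0, f 1⁆ := (lie_skew _ _).symm
    have k21 : ⁅f 2, f 1⁆ = -⁅f 1, f 2⁆ := (lie_skew _ _).symm
    fin_cases i <;> fin_cases j <;>
      simp [h10, h21, k10, k21, he.lie_zero_one, he.lie_one_two, he.lie_zero_two, he.lie_two_zero,
        hf.lie_zero_one, hf.lie_one_two, hf.lie_zero_two, hf.lie_two_zero, hφ]
  exact ⟨{ φ with map_lie' := fun {x y} => LinearMap.congr_fun₂ key x y }⟩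

theorem Admits.of_iso (hL : Admits L A) (h : Iso L M) : Admits M A := by
  obtain ⟨e, he⟩ := hL
  obtain ⟨φ⟩ := h
  refine ⟨e.map φ.toLinearEquiv, fun l => ?_⟩
  have := congrArg φ (he l)
  rw [LieEquiv.map_lie, map_sum] at this
  simpa using this

theorem Iso.symm (h : Iso L M) : Iso M L := h.map LieEquiv.symm

/-- A change of basis P acts on Λ²L by its cofactor matrix, so the new structure matrix is P⁻¹ A
adj(P)ᵀ; the condition avoids the inverse. -/
theorem Admits.congr {A' : Matrix (Fin 3) (Fin 3) ℝ} (hL : Admits L A)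
    {P : Matrix (Fin 3) (Fin 3) ℝ} (hP : P.det ≠ 0) (h : P * A' = A * P.adjugate.transpose) :
    Admits L A' := by
  obtain ⟨e, he⟩ := hL
  let φ : L ≃ₗ[ℝ] L := LinearEquiv.ofIsUnitDet (f := Matrix.toLin e e P) (v := e) (v' := e)
    (by rw [LinearMap.toMatrix_toLin]; exact isUnit_iff_ne_zero.2 hP)
  have hφ : ∀ i, e.map φ i = P 0 i • e 0 + P 1 i • e 1 + P 2 i • e 2 := fun i => by
    change Matrix.toLin e e P (e i) = _
    rw [Matrix.toLin_self, Fin.sum_univ_three]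
  have h10 : ⁅e 1, e 0⁆ = -⁅e 0, e 1⁆ := (lie_skew _ _).symm
  have h21 : ⁅e 2, e 1⁆ = -⁅e 1, e 2⁆ := (lie_skew _ _).symm
  have hent := fun i j => congrFun (congrFun h i) j
  simp only [Matrix.mul_apply, Fin.sum_univ_three, Matrix.adjugate_fin_three] at hent
  refine ⟨e.map φ, fun l => ?_⟩
  rw [Fin.sum_univ_three, hφ, hφ, hφ, hφ, hφ]
  simp only [add_lie, lie_add, smul_lie, lie_smul, lie_self, h10, h21, he.lie_zero_one,
    he.lie_one_two, he.lie_zero_two, he.lie_two_zero]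
  have h0 := hent 0 l
  have h1 := hent 1 l
  have h2 := hent 2 l
  fin_cases l <;> simp at h0 h1 h2 ⊢ <;>
    linear_combination (norm := module) -(h0 • e 0) - h1 • e 1 - h2 • e 2

theorem isLieAbelian_iff (h : Admits L A) : IsLieAbelian L ↔ A = 0 := by
  constructor
  · intro hab
    obtain ⟨e, he⟩ := h
    ext k l
    have := congrArg (fun x => e.repr x k) (he l)
    rw [hab.trivial] at this
    simpa [Finsupp.single_apply] using this.symm
  · rintro rfl
    obtain ⟨e, he⟩ := h
    have key : (LieModule.toEnd ℝ L L : L →ₗ[ℝ] L →ₗ[ℝ] L) = 0 := by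
      have h10 : ⁅e 1, e 0⁆ = -⁅e 0, e 1⁆ := (lie_skew _ _).symm
      have h21 : ⁅e 2, e 1⁆ = -⁅e 1, e 2⁆ := (lie_skew _ _).symm
      refine e.ext fun i => e.ext fun j => ?_
      change ⁅e i, e j⁆ = 0
      fin_cases i <;> fin_cases j <;>
        simp [h10, h21, he.lie_zero_one, he.lie_one_two, he.lie_zero_two, he.lie_two_zero]
    exact ⟨fun x y => LinearMap.congr_fun₂ key x y⟩

/-- The traces of ad on the basis vectors are, up to sign, the entries of A - Aᵀ. -/
theorem isUnimodular_iff (h : Admits L A) :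
    IsUnimodular L ↔ A 0 1 = A 1 0 ∧ A 0 2 = A 2 0 ∧ A 1 2 = A 2 1 := by
  obtain ⟨e, he⟩ := h
  have h10 : ⁅e 1, e 0⁆ = -⁅e 0, e 1⁆ := (lie_skew _ _).symm
  have h21 : ⁅e 2, e 1⁆ = -⁅e 1, e 2⁆ := (lie_skew _ _).symm
  have htr : ∀ x, LinearMap.trace ℝ L (LieAlgebra.ad ℝ L x) = e.repr ⁅x, e 0⁆ 0 +
      e.repr ⁅x, e 1⁆ 1 + e.repr ⁅x, e 2⁆ 2 := fun x => by
    rw [LinearMap.trace_eq_matrix_trace ℝ e, Matrix.trace, Fin.sum_univ_three]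
    simp [LinearMap.toMatrix_apply]
  have h0 : LinearMap.trace ℝ L (LieAlgebra.ad ℝ L (e 0)) = A 1 2 - A 2 1 := by
    rw [htr]; simp [he.lie_zero_one, he.lie_zero_two]; ring
  have h1 : LinearMap.trace ℝ L (LieAlgebra.ad ℝ L (e 1)) = A 2 0 - A 0 2 := by
    rw [htr]; simp [he.lie_zero_one, he.lie_one_two, h10]; ring
  have h2 : LinearMap.trace ℝ L (LieAlgebra.ad ℝ L (e 2)) = A 0 1 - A 1 0 := by
    rw [htr]; simp [he.lie_two_zero, he.lie_one_two, h21]; ring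
  constructor
  · intro hu
    have := hu (e 0); have := hu (e 1); have := hu (e 2)
    refine ⟨?_, ?_, ?_⟩ <;> linarith
  · rintro ⟨k0, k1, k2⟩
    have key : LinearMap.trace ℝ L ∘ₗ (LieAlgebra.ad ℝ L : L →ₗ[ℝ] Module.End ℝ L) = 0 := by
      refine e.ext fun i => ?_
      change LinearMap.trace ℝ L (LieAlgebra.ad ℝ L (e i)) = 0
      fin_cases i <;> simp only [Fin.zero_eta, Fin.mk_one, Fin.reduceFinMk] <;> linarith
    exact fun x => LinearMap.congr_fun key x

theorem exists_admits (h : finrank ℝ L = 3) : ∃ A, Admits L A := by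
  have : Module.Finite ℝ L := Module.finite_of_finrank_pos (by omega)
  obtain ⟨A, hA⟩ := exists_hasStructure (finBasisOfFinrankEq ℝ L h)
  exact ⟨A, _, hA⟩

/-- The consequence of the Jacobi identity when the third basis vector spans
`[e 0, e 1]` and the plane of the first two is stable under its action. -/
theorem jacobi_of_admits (h : Admits L A) (h02 : A 0 2 = 0) (h12 : A 1 2 = 0) (h20 : A 2 0 = 0)
    (h21' : A 2 1 = 0) : A 2 2 * (A 0 1 - A 1 0) = 0 := by
  obtain ⟨e, he⟩ := h
  have h10 : ⁅e 1, e 0⁆ = -⁅e 0, e 1⁆ := (lie_skew _ _).symm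
  have := lie_jacobi (e 0) (e 1) (e 2)
  have := congrArg (fun x => e.repr x 2) this
  simp [he.lie_zero_one, he.lie_one_two, he.lie_two_zero, h02, h12, h20, h21',
    h10] at this
  linarith

end Structure

/-! ### Structure matrices of the model algebras. -/

section Models

/-- The basis lists the abelian plane first and the acting vector last, so the third row and column
vanish. -/
theorem admits_planeExt (M : Matrix (Fin 2) (Fin 2) ℝ) :
    Admits (PlaneExt M) !![-M 0 1, M 0 0, 0; -M 1 1, M 1 0, 0; 0, 0, 0] := by
  let φ : PlaneExt M ≃ₗ[ℝ] (Fin 3 → ℝ) :=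
    { toFun := fun x => ![x.2 0, x.2 1, x.1]
      invFun := fun v => (v 2, ![v 0, v 1])
      map_add' := fun x y => by ext i; fin_cases i <;> rfl
      map_smul' := fun t x => by ext i; fin_cases i <;> rfl
      left_inv := fun x => Prod.ext rfl (by ext i; fin_cases i <;> rfl)
      right_inv := fun v => by ext i; fin_cases i <;> rfl }
  have h : ∀ i, Basis.ofEquivFun φ i = ((Pi.single i (1 : ℝ) : Fin 3 → ℝ) 2,
      ![(Pi.single i (1 : ℝ) : Fin 3 → ℝ) 0, (Pi.single i (1 : ℝ) : Fin 3 → ℝ) 1]) :=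
    fun i => by rw [Basis.coe_ofEquivFun]; rfl
  refine ⟨Basis.ofEquivFun φ, fun l => φ.injective ?_⟩
  simp only [map_sum, map_smul, Basis.coe_ofEquivFun, LinearEquiv.apply_symm_apply]
  have h' : ∀ i, φ.symm (Pi.single i 1) = ((Pi.single i (1 : ℝ) : Fin 3 → ℝ) 2,
      ![(Pi.single i (1 : ℝ) : Fin 3 → ℝ) 0, (Pi.single i (1 : ℝ) : Fin 3 → ℝ) 1]) :=
    fun i => rfl
  have hb : ∀ x y : PlaneExt M, φ ⁅x, y⁆ = ![(x.1 • M.mulVec y.2 - y.1 • M.mulVec x.2) 0,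
    (x.1 • M.mulVec y.2 - y.1 • M.mulVec x.2) 1, 0] := fun x y => rfl
  rw [hb, h', h']
  ext k
  fin_cases l <;> fin_cases k <;>
    simp [Pi.single_apply]

attribute [local instance] LieRing.ofAssociativeRing

theorem admits_su2 : Admits su2 (Matrix.diagonal ![-2, -2, -2]) := by
  -- Coordinates with respect to i times the Pauli matrices.
  let φ : su2 ≃ₗ[ℝ] (Fin 3 → ℝ) :=
    { toFun := fun X => ![(X.1 0 1).im, (X.1 0 1).re, (X.1 0 0).im]
      invFun := fun v => ⟨!![⟨0, v 2⟩, ⟨v 1, v 0⟩; ⟨-v 1, v 0⟩, ⟨0, -v 2⟩], by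
        refine ⟨?_, ?_⟩
        · ext i j; fin_cases i <;> fin_cases j <;> apply Complex.ext <;> simp
        · apply Complex.ext <;> simp [Matrix.trace_fin_two]⟩
      map_add' := fun x y => by ext i; fin_cases i <;> simp
      map_smul' := fun t x => by ext i; fin_cases i <;> simp
      left_inv := fun X => by
        obtain ⟨X, h1, h2⟩ := X
        have h00 := congrFun (congrFun h1 0) 0
        have h10 := congrFun (congrFun h1 1) 0
        rw [Matrix.trace_fin_two] at h2
        simp [Complex.ext_iff] at h00 h10 h2
        refine Subtype.ext ?_
        ext i j; fin_cases i <;> fin_cases j <;> apply Complex.ext <;> simp <;> linarith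
      right_inv := fun v => by ext i; fin_cases i <;> simp }
  refine ⟨Basis.ofEquivFun φ, fun l => φ.injective ?_⟩
  simp only [map_sum, map_smul, Basis.coe_ofEquivFun, LinearEquiv.apply_symm_apply]
  have h' : ∀ v : Fin 3 → ℝ, (φ.symm v : Matrix (Fin 2) (Fin 2) ℂ) =
    !![⟨0, v 2⟩, ⟨v 1, v 0⟩; ⟨-v 1, v 0⟩, ⟨0, -v 2⟩] := fun i => rfl
  have hb : ∀ x y : su2, φ ⁅x, y⁆ = ![((x.1 * y.1 - y.1 * x.1) 0 1).im,
    ((x.1 * y.1 - y.1 * x.1) 0 1).re, ((x.1 * y.1 - y.1 * x.1) 0 0).im] := fun x y => rfl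
  rw [hb, h', h']
  ext k
  fin_cases l <;> fin_cases k <;>
    simp [Fin.sum_univ_succ, Matrix.diagonal] <;> norm_num

theorem admits_sl2 : Admits sl2 (Matrix.diagonal ![-2, 2, -2]) := by
  have tr0 : ∀ X : sl2, X.1 1 1 = -X.1 0 0 := fun X => by
    have : X.1.trace = 0 := X.2
    rw [Matrix.trace_fin_two] at this
    linarith
  -- Coordinates with respect to E + F, E - F, H; the compact direction E - F carries the opposite
  -- sign.
  let φ : sl2 ≃ₗ[ℝ] (Fin 3 → ℝ) :=
    { toFun := fun X => ![(X.1 0 1 + X.1 1 0) / 2, (X.1 0 1 - X.1 1 0) / 2, X.1 0 0]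
      invFun := fun v => ⟨!![v 2, v 0 + v 1; v 0 - v 1, -v 2], by
        change Matrix.trace (n := Fin 2) (R := ℝ) _ = 0
        simp [Matrix.trace_fin_two]⟩
      map_add' := fun x y => by ext i; fin_cases i <;> simp <;> ring
      map_smul' := fun t x => by ext i; fin_cases i <;> simp <;> ring
      left_inv := fun X => by
        have := tr0 X
        refine Subtype.ext ?_
        ext i j; fin_cases i <;> fin_cases j <;> simp <;> linarith
      right_inv := fun v => by ext i; fin_cases i <;> simp }
  refine ⟨Basis.ofEquivFun φ, fun l => φ.injective ?_⟩
  simp only [map_sum, map_smul, Basis.coe_ofEquivFun, LinearEquiv.apply_symm_apply]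
  have h' : ∀ v : Fin 3 → ℝ, (φ.symm v : Matrix (Fin 2) (Fin 2) ℝ) =
    !![v 2, v 0 + v 1; v 0 - v 1, -v 2] := fun i => rfl
  have hb : ∀ x y : sl2, φ ⁅x, y⁆ = ![((x.1 * y.1 - y.1 * x.1) 0 1 +
      (x.1 * y.1 - y.1 * x.1) 1 0) / 2, ((x.1 * y.1 - y.1 * x.1) 0 1 -
      (x.1 * y.1 - y.1 * x.1) 1 0) / 2, (x.1 * y.1 - y.1 * x.1) 0 0] := fun x y => rfl
  rw [hb, h', h']
  ext k
  fin_cases l <;> fin_cases k <;>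
    simp [Fin.sum_univ_succ, Matrix.diagonal] <;> norm_num

end Models

/-! ### Normal forms of structure matrices under change of basis. -/

section Normalization

variable {L : Type*} [LieRing L] [LieAlgebra ℝ L]

theorem Admits.smul {A : Matrix (Fin 3) (Fin 3) ℝ} (h : Admits L A) {t : ℝ} (ht : t ≠ 0) :
    Admits L (t • A) := by
  refine h.congr (P := Matrix.diagonal ![t, t, t]) (by simp [Fin.prod_univ_three, ht]) ?_
  ext i j
  fin_cases i <;> fin_cases j <;>
    simp [Matrix.mul_apply, Fin.sum_univ_three, Matrix.adjugate_fin_three, Matrix.diagonal] <;> ring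

theorem Admits.neg {A : Matrix (Fin 3) (Fin 3) ℝ} (h : Admits L A) : Admits L (-A) := by
  simpa using h.smul (t := -1) (by norm_num)

theorem Admits.diagonal_neg {x y z : ℝ} (h : Admits L (Matrix.diagonal ![x, y, z])) :
    Admits L (Matrix.diagonal ![-x, -y, -z]) := by
  convert h.neg using 1
  ext i j
  fin_cases i <;> fin_cases j <;> simp [Matrix.diagonal]

theorem Admits.diagonal_scale {x y z : ℝ} (h : Admits L (Matrix.diagonal ![x, y, z]))
    {p q r : ℝ} (hp : 0 < p) (hq : 0 < q) (hr : 0 < r) :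
    Admits L (Matrix.diagonal ![p * x, q * y, r * z]) := by
  have h1 : √p * √p = p := Real.mul_self_sqrt hp.le
  have h2 : √q * √q = q := Real.mul_self_sqrt hq.le
  have h3 : √r * √r = r := Real.mul_self_sqrt hr.le
  have k1 := (Real.sqrt_pos.2 hp).ne'
  have k2 := (Real.sqrt_pos.2 hq).ne'
  have k3 := (Real.sqrt_pos.2 hr).ne'
  -- A diagonal P multiplies each entry by the product of the other two scales over its own scale;
  -- these scales produce exactly p, q, r. Only the signs of the diagonal entries therefore matter.
  refine h.congr (P := Matrix.diagonal ![√q * √r, √p * √r, √p * √q])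
    (by simp [Fin.prod_univ_three, k1, k2, k3]) ?_
  ext i j
  fin_cases i <;> fin_cases j <;>
    simp [Matrix.mul_apply, Matrix.adjugate_fin_three, Matrix.diagonal] <;>
    grind

theorem Admits.diagonal_swap {x y z : ℝ} (h : Admits L (Matrix.diagonal ![x, y, z])) :
    Admits L (Matrix.diagonal ![y, x, z]) := by
  -- The entry -1 gives P determinant one, so that the signs of x, y, z are kept.
  refine h.congr (P := !![0, 1, 0; 1, 0, 0; 0, 0, -1]) (by simp [Matrix.det_fin_three]) ?_
  ext i j
  fin_cases i <;> fin_cases j <;>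
    simp [Matrix.mul_apply, Matrix.adjugate_fin_three, Matrix.diagonal]

theorem Admits.diagonal_rotate {x y z : ℝ} (h : Admits L (Matrix.diagonal ![x, y, z])) :
    Admits L (Matrix.diagonal ![y, z, x]) := by
  refine h.congr (P := !![0, 0, 1; 1, 0, 0; 0, 1, 0]) (by simp [Matrix.det_fin_three]) ?_
  ext i j
  fin_cases i <;> fin_cases j <;>
    simp [Matrix.mul_apply, Matrix.adjugate_fin_three, Matrix.diagonal]

/-- A rotation by which a binary quadratic form is diagonalized. -/
theorem exists_rotation (x y : ℝ) :
    ∃ c s : ℝ, c * c + s * s = 1 ∧ x * (c * s) = y * (c * c - s * s) := by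
  -- The condition reads x sin 2φ = 2y cos 2φ, so 2φ may be taken to be the argument of x + 2iy.
  let w : ℂ := ⟨x, 2 * y⟩
  refine ⟨Real.cos (w.arg / 2), Real.sin (w.arg / 2), ?_, ?_⟩
  · have := Real.cos_sq_add_sin_sq (w.arg / 2); linarith
  · have hx : ‖w‖ * Real.cos w.arg = x := Complex.norm_mul_cos_arg w
    have hy : ‖w‖ * Real.sin w.arg = 2 * y := Complex.norm_mul_sin_arg w
    have hc : Real.cos w.arg = Real.cos (w.arg / 2) * Real.cos (w.arg / 2)
        - Real.sin (w.arg / 2) * Real.sin (w.arg / 2) := by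
      rw [← Real.cos_add]; ring_nf
    have hs : Real.sin w.arg = 2 * (Real.cos (w.arg / 2) * Real.sin (w.arg / 2)) := by
      rw [show w.arg = w.arg / 2 + w.arg / 2 by ring, Real.sin_add]; ring_nf
    have : y = ‖w‖ * (Real.cos (w.arg / 2) * Real.sin (w.arg / 2)) := by
      rw [hs] at hy; linarith
    rw [← hc, ← hx, this]
    ring

/-- A rotation is its own cofactor matrix, so it acts on structure matrices by conjugation. -/
theorem Admits.rotation {p q r u k c s : ℝ} (h : Admits L !![p, q, 0; r, u, 0; 0, 0, k])
    (hcs : c * c + s * s = 1) :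
    Admits L !![c * (p * c + q * s) + s * (r * c + u * s),
      c * (q * c - p * s) + s * (u * c - r * s), 0;
      c * (r * c + u * s) - s * (p * c + q * s),
      c * (u * c - r * s) - s * (q * c - p * s), 0; 0, 0, k] := by
  refine h.congr (P := !![c, -s, 0; s, c, 0; 0, 0, 1])
    (by simp [Matrix.det_fin_three, hcs]) ?_
  ext i j
  fin_cases i <;> fin_cases j <;>
    simp [Matrix.mul_apply, Fin.sum_univ_three, Matrix.adjugate_fin_three] <;> grind

/-- A symmetric block can be diagonalized. -/
theorem Admits.exists_diagonal {p q r k : ℝ} (h : Admits L !![p, q, 0; q, r, 0; 0, 0, k]) :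
    ∃ x y, x + y = p + r ∧ x * y = p * r - q * q ∧ Admits L (Matrix.diagonal ![x, y, k]) := by
  obtain ⟨c, s, hcs, h0⟩ := exists_rotation (p - r) q
  refine ⟨c * (p * c + q * s) + s * (q * c + r * s), c * (r * c - q * s) - s * (q * c - p * s),
    ?_, ?_, ?_⟩
  rotate_left 2
  · convert h.rotation hcs using 1
    ext i j
    fin_cases i <;> fin_cases j <;> simp [Matrix.diagonal]
    · linear_combination h0
    · linear_combination h0
  · linear_combination (p + r) * hcs
  · grind

/-- The structure matrix of `ℝ ⋉ ℝ²` for a diagonal action. -/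
theorem Admits.exists_planar {p q r : ℝ} (h : Admits L !![p, q, 0; r, -p, 0; 0, 0, 0]) :
    ∃ x y, x + y = q - r ∧ x * y = -(q * r) - p * p ∧
      Admits L !![0, x, 0; -y, 0, 0; 0, 0, 0] := by
  -- A trace-free block means that the third vector acts on the plane by the symmetric matrix with
  -- rows (q, -p), (-p, -r); the rotation diagonalizes this action, and x, y are its eigenvalues.
  obtain ⟨c, s, hcs, h0⟩ := exists_rotation (q + r) (-p)
  refine ⟨c * (q * c - p * s) + s * (-p * c - r * s), s * (p * c + q * s) - c * (r * c + -p * s),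
    ?_, ?_, ?_⟩
  rotate_left 2
  · convert h.rotation hcs using 1
    ext i j
    fin_cases i <;> fin_cases j <;> simp
    · linear_combination -h0
    · linear_combination h0
  · linear_combination (q - r) * hcs
  · grind

theorem Admits.planar_scale {x y t : ℝ} (h : Admits L !![0, x, 0; -y, 0, 0; 0, 0, 0])
    (ht : t ≠ 0) : Admits L !![0, t * x, 0; -(t * y), 0, 0; 0, 0, 0] := by
  refine h.congr (P := !![1, 0, 0; 0, 1, 0; 0, 0, t]) (by simp [Matrix.det_fin_three, ht]) ?_
  ext i j
  fin_cases i <;> fin_cases j <;>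
    simp [Matrix.mul_apply, Fin.sum_univ_three, Matrix.adjugate_fin_three] <;> ring

theorem Admits.planar_swap {x y : ℝ} (h : Admits L !![0, x, 0; -y, 0, 0; 0, 0, 0]) :
    Admits L !![0, y, 0; -x, 0, 0; 0, 0, 0] := by
  refine h.congr (P := !![0, 1, 0; 1, 0, 0; 0, 0, 1]) (by simp [Matrix.det_fin_three]) ?_
  ext i j
  fin_cases i <;> fin_cases j <;>
    simp [Matrix.mul_apply, Fin.sum_univ_three, Matrix.adjugate_fin_three]

end Normalization

/-! ### Recognizing the algebras from signs. -/

section Classification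

variable {L : Type*} [LieRing L] [LieAlgebra ℝ L]

theorem admits_e2 {x z : ℝ} (hx : 0 < x) (hz : 0 < z) :
    Admits e2 (Matrix.diagonal ![x, 0, z]) := by
  have h : Admits e2 (Matrix.diagonal ![-1, -1, 0]) := by
    convert admits_planeExt !![0, 1; -1, 0] using 1
    ext i j
    fin_cases i <;> fin_cases j <;> simp [Matrix.diagonal]
  have h' := h.diagonal_neg.diagonal_rotate.diagonal_scale hx one_pos hz
  simpa using h'

theorem admits_su2_of_pos {x y z : ℝ} (hx : 0 < x) (hy : 0 < y) (hz : 0 < z) :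
    Admits su2 (Matrix.diagonal ![x, y, z]) := by
  have h := admits_su2.diagonal_neg.diagonal_scale (half_pos hx) (half_pos hy) (half_pos hz)
  simpa using h

theorem admits_sl2_of_pos_of_neg {x y z : ℝ} (hx : 0 < x) (hy : y < 0) (hz : 0 < z) :
    Admits sl2 (Matrix.diagonal ![x, y, z]) := by
  have h := admits_sl2.diagonal_neg.diagonal_scale (half_pos hx) (half_pos (neg_pos.2 hy))
    (half_pos hz)
  simpa [neg_div] using h

theorem admits_r3 (μ : ℝ) : Admits (r3 μ) !![0, 1, 0; -μ, 0, 0; 0, 0, 0] := by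
  simpa using admits_planeExt !![1, 0; 0, μ]

theorem admits_Rr2 : Admits Rr2 !![0, 1, 0; -0, 0, 0; 0, 0, 0] := by
  simpa using admits_planeExt !![1, 0; 0, 0]

theorem admits_e11 : Admits e11 (Matrix.diagonal ![-1, 1, 0]) := by
  convert admits_planeExt !![0, 1; 1, 0] using 1
  ext i j
  fin_cases i <;> fin_cases j <;> simp [Matrix.diagonal]

/-- Reversing the basis makes both z and x + y positive. Then x and y are both positive, or one
vanishes and the other is positive, or they have opposite signs, and positive rescaling reaches the
model. -/
theorem iso_of_diagonal {x y z : ℝ} (h : Admits L (Matrix.diagonal ![x, y, z]))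
    (hz : 0 < z * (x + y)) :
    (0 < x * y → Iso L su2) ∧ (x * y = 0 → Iso L e2) ∧ (x * y < 0 → Iso L sl2) := by
  have key : ∀ x y z : ℝ, Admits L (Matrix.diagonal ![x, y, z]) → 0 < z → 0 < x + y →
      (0 < x * y → Iso L su2) ∧ (x * y = 0 → Iso L e2) ∧ (x * y < 0 → Iso L sl2) := by
    intro x y z h hz hxy
    refine ⟨fun hp => ?_, fun h0 => ?_, fun hn => ?_⟩
    · have hx : 0 < x := by nlinarith
      have hy : 0 < y := by nlinarith
      exact iso_of_admits h (admits_su2_of_pos hx hy hz)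
    · rcases mul_eq_zero.1 h0 with rfl | rfl
      · exact iso_of_admits h.diagonal_swap (admits_e2 (by linarith) hz)
      · exact iso_of_admits h (admits_e2 (by linarith) hz)
    · rcases mul_neg_iff.1 hn with ⟨hx, hy⟩ | ⟨hx, hy⟩
      · exact iso_of_admits h (admits_sl2_of_pos_of_neg hx hy hz)
      · exact iso_of_admits h.diagonal_swap (admits_sl2_of_pos_of_neg hy hx hz)
  rcases mul_pos_iff.1 hz with ⟨h1, h2⟩ | ⟨h1, h2⟩
  · exact key x y z h h1 h2
  · simpa using key _ _ _ h.diagonal_neg (by linarith) (by linarith)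

theorem iso_r3_of_planar {x y : ℝ} (h : Admits L !![0, x, 0; -y, 0, 0; 0, 0, 0]) (hx : x ≠ 0) :
    Iso L (r3 (y / x)) := by
  have h' := h.planar_scale (inv_ne_zero hx)
  rw [inv_mul_cancel₀ hx, mul_comm, ← div_eq_mul_inv] at h'
  exact iso_of_admits h' (admits_r3 _)

/-- The action is diag(x, y). Dividing by the eigenvalue of larger modulus leaves μ in [-1, 1], and
x + y ≠ 0 excludes μ = -1. -/
theorem iso_of_planar {x y : ℝ} (h : Admits L !![0, x, 0; -y, 0, 0; 0, 0, 0]) (hxy : x + y ≠ 0) :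
    (0 < x * y → ∃ μ, 0 < μ ∧ μ ≤ 1 ∧ Iso L (r3 μ)) ∧ (x * y = 0 → Iso L Rr2) ∧
      (x * y < 0 → ∃ μ, -1 < μ ∧ μ < 0 ∧ Iso L (r3 μ)) := by
  have key : ∀ x y : ℝ, Admits L !![0, x, 0; -y, 0, 0; 0, 0, 0] → x + y ≠ 0 → |y| ≤ |x| →
      (0 < x * y → ∃ μ, 0 < μ ∧ μ ≤ 1 ∧ Iso L (r3 μ)) ∧ (x * y = 0 → Iso L Rr2) ∧
        (x * y < 0 → ∃ μ, -1 < μ ∧ μ < 0 ∧ Iso L (r3 μ)) := by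
    intro x y h hxy hle
    have hx : x ≠ 0 := by
      rintro rfl
      simp only [abs_zero, abs_nonpos_iff] at hle
      simp [hle] at hxy
    have hiso := iso_r3_of_planar h hx
    have hx2 : 0 < x * x := mul_self_pos.2 hx
    have hq : y / x * (x * x) = x * y := by field_simp
    have habs : |y / x| ≤ 1 := by rw [abs_div]; exact div_le_one_of_le₀ hle (abs_nonneg _)
    rw [abs_le] at habs
    refine ⟨fun hp => ⟨y / x, ?_, habs.2, hiso⟩, fun h0 => ?_, fun hn => ⟨y / x, ?_, ?_, hiso⟩⟩
    · exact pos_of_mul_pos_left (hq ▸ hp) hx2.le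
    · have hy : y = 0 := (mul_eq_zero.1 h0).resolve_left hx
      subst hy
      have h' := h.planar_scale (inv_ne_zero hx)
      rw [inv_mul_cancel₀ hx, mul_zero] at h'
      exact iso_of_admits h' admits_Rr2
    · refine lt_of_le_of_ne habs.1 fun heq => hxy ?_
      rw [eq_div_iff hx] at heq
      linarith
    · by_contra! hc
      nlinarith [mul_nonneg hc hx2.le]
  rcases le_total |y| |x| with hle | hle
  · exact key x y h hxy hle
  · have := key y x h.planar_swap (by rwa [add_comm]) hle
    rwa [mul_comm y x] at this

/-- The action is symmetric and trace-free with determinant -(p² + q²) ≠ 0, so its eigenvalues are x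
and -x; scaling makes them 1 and -1, the form used to recognize e(1,1). -/
theorem admits_of_traceless {p q : ℝ} (h : Admits L !![p, q, 0; q, -p, 0; 0, 0, 0])
    (h0 : p * p + q * q ≠ 0) : Admits L !![0, 1, 0; - -1, 0, 0; 0, 0, 0] := by
  obtain ⟨x, y, hs, hp, hxy⟩ := h.exists_planar
  have hy : y = -x := by linarith
  subst hy
  have hx : x ≠ 0 := by
    rintro rfl
    apply h0
    linarith
  have h' := hxy.planar_scale (inv_ne_zero hx)
  rwa [mul_neg, inv_mul_cancel₀ hx] at h'

theorem admits_e11_planar : Admits e11 !![0, 1, 0; - -1, 0, 0; 0, 0, 0] := by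
  refine admits_of_traceless (p := -1) (q := 0) ?_ (by norm_num)
  convert admits_e11 using 1
  ext i j
  fin_cases i <;> fin_cases j <;> simp [Matrix.diagonal]

end Classification

/-! ### Solutions of the equations with a ≠ 0. -/

section TypeII

variable {L₁ L₂ : Type*} [LieRing L₁] [LieAlgebra ℝ L₁] [LieRing L₂] [LieAlgebra ℝ L₂]
  {A B : Matrix (Fin 3) (Fin 3) ℝ} {a α β : ℝ}

/-- This quantity and its mirror image under exchange of α and β are the determinants of the 2 × 2
systems occurring below. -/
theorem sq_add_sq_pos (ha0 : a ≠ 0) (hne : α ≠ 0 ∨ β ≠ 0) : 0 < α * α + β * β * (a * a) := by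
  have ha2 : 0 < a * a := mul_self_pos.2 ha0
  rcases hne with h | h
  · have := mul_self_pos.2 h
    have := mul_nonneg (mul_self_nonneg β) ha2.le
    linarith
  · have := mul_pos (mul_self_pos.2 h) ha2
    have := mul_self_nonneg α
    linarith

/-- Closedness of Re Ψ contains two homogeneous 2 × 2 systems with positive determinant, which kill
the skew parts of the third row and column of A and of B. With a ≠ 0, closedness of ω ∧ ω then
removes the remaining off-block entries of A. -/
theorem HalfFlatEquations.block (h : HalfFlatEquations A B a α β) (ha0 : a ≠ 0)
    (hne : α ≠ 0 ∨ β ≠ 0) : A 0 2 = 0 ∧ A 1 2 = 0 ∧ A 2 0 = 0 ∧ A 2 1 = 0 := by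
  have hP := (sq_add_sq_pos ha0 hne).ne'
  have hQ := (sq_add_sq_pos ha0 hne.symm).ne'
  obtain ⟨⟨h1, h2, h3, h4, h5, h6⟩, k1, k2, k3, k4, k5, k6, k7, k8, k9, k10, k11, k12, k13, k14,
    k15⟩ := h
  have hX : A 2 1 - A 1 2 = 0 := (mul_eq_zero.1 (show (α * α + β * β * (a * a)) * _ = 0 by
    linear_combination α * k1 - β * a * k2)).resolve_left hP
  have hY : A 0 2 - A 2 0 = 0 := (mul_eq_zero.1 (show (α * α + β * β * (a * a)) * _ = 0 by
    linear_combination β * a * k1 + α * k2)).resolve_left hP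
  have hU : B 1 2 - B 2 1 = 0 := (mul_eq_zero.1 (show (β * β + α * α * (a * a)) * _ = 0 by
    linear_combination β * k10 - α * a * k14)).resolve_left hQ
  have hW : B 2 0 - B 0 2 = 0 := (mul_eq_zero.1 (show (β * β + α * α * (a * a)) * _ = 0 by
    linear_combination β * k14 + α * a * k10)).resolve_left hQ
  have h21 : A 2 1 = 0 := (mul_eq_zero.1 (show a * A 2 1 = 0 by
    linear_combination -h5 - √(1 - a ^ 2) * hW)).resolve_left ha0
  have h20 : A 2 0 = 0 := (mul_eq_zero.1 (show a * A 2 0 = 0 by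
    linear_combination h6 - √(1 - a ^ 2) * hU)).resolve_left ha0
  exact ⟨by linarith, by linarith, h20, h21⟩

theorem eq_block (h02 : A 0 2 = 0) (h12 : A 1 2 = 0) (h20 : A 2 0 = 0) (h21 : A 2 1 = 0) :
    A = !![A 0 0, A 0 1, 0; A 1 0, A 1 1, 0; 0, 0, A 2 2] := by
  ext i j
  fin_cases i <;> fin_cases j <;> simp [*]

/-- For the upper-left blocks A', B' the equations coupling them read R A' = -B'ᵀ R', where R has
determinant β² + α²a² and R' has determinant α² + β²a². Taking determinants gives the identity; the
common extra factor is cancelled where it is used. -/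
theorem HalfFlatEquations.det_eq (h : HalfFlatEquations A B a α β) (hA : A 0 1 = A 1 0) :
    (A 0 0 * A 1 1 - A 0 1 * A 0 1) * (β * β + α * α * (a * a)) * (β * β + α * α * (a * a)) =
      (B 0 0 * B 1 1 - B 0 1 * B 1 0) * (α * α + β * β * (a * a)) *
        (β * β + α * α * (a * a)) := by
  obtain ⟨-, k1, k2, k3, k4, k5, k6, k7, k8, k9, k10, k11, k12, k13, k14, k15⟩ := h
  rw [← hA] at k12 k13
  have e1 : β * A 1 1 + α * a * A 0 1 = -(α * B 1 1 + β * a * B 0 1) := by linarith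
  have e2 : β * A 0 1 - α * a * A 1 1 = -(α * B 1 0 + β * a * B 0 0) := by linarith
  have e3 : β * A 0 1 + α * a * A 0 0 = -(α * B 0 1 - β * a * B 1 1) := by linarith
  have e4 : β * A 0 0 - α * a * A 0 1 = -(α * B 0 0 - β * a * B 1 0) := by linarith
  have : (A 0 0 * A 1 1 - A 0 1 * A 0 1) * (β * β + α * α * (a * a)) =
      (β * A 1 1 + α * a * A 0 1) * (β * A 0 0 - α * a * A 0 1) -
        (β * A 0 1 - α * a * A 1 1) * (β * A 0 1 + α * a * A 0 0) := by ring
  rw [this, e1, e2, e3, e4]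
  ring

/-- The classification when the first summand is not a semidirect product by a plane. -/
theorem iso_of_halfFlatEquations (hL₁ : Admits L₁ A) (hL₂ : Admits L₂ B)
    (h : HalfFlatEquations A B a α β) (ha : a ^ 2 ≤ 1) (ha0 : a ≠ 0) (hne : α ≠ 0 ∨ β ≠ 0)
    (hk : A 2 2 ≠ 0) :
    (Iso L₁ e2 ∧ Iso L₂ Rr2) ∨ (∃ μ, 0 < μ ∧ μ ≤ 1 ∧ Iso L₁ su2 ∧ Iso L₂ (r3 μ)) ∨
      (∃ μ, -1 < μ ∧ μ < 0 ∧ Iso L₁ sl2 ∧ Iso L₂ (r3 μ)) := by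
  obtain ⟨a02, a12, a20, a21⟩ := h.block ha0 hne
  obtain ⟨b02, b12, b20, b21⟩ := h.symm.block ha0 hne.symm
  have hsym : A 0 1 - A 1 0 = 0 :=
    (mul_eq_zero.1 (jacobi_of_admits hL₁ a02 a12 a20 a21)).resolve_left hk
  have hdet := h.det_eq (sub_eq_zero.1 hsym)
  have hP := sq_add_sq_pos ha0 hne
  have hQ := sq_add_sq_pos ha0 hne.symm
  have hs : √(1 - a ^ 2) * √(1 - a ^ 2) = 1 - a ^ 2 := Real.mul_self_sqrt (by linarith)
  obtain ⟨⟨h1, h2, h3, h4, h5, h6⟩, k1, k2, k3, k4, k5, k6, k7, k8, k9, k10, k11, k12, k13, k14,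
    k15⟩ := h
  have b22 : B 2 2 = 0 := (mul_eq_zero.1 (show a * B 2 2 = 0 by
    linear_combination h1 - hsym)).resolve_left ha0
  -- The second algebra is not unimodular: its skew part equals -a times the corner of A.
  have hδ : B 0 1 - B 1 0 ≠ 0 := by
    intro h0
    exact mul_ne_zero ha0 hk (by linear_combination h4 - h0)
  have hβs : β * √(1 - a ^ 2) = 0 := (mul_eq_zero.1 k15).resolve_right hδ
  have hR : 0 < α * α + β * β := by
    rcases hne with h | h
    · have := mul_self_pos.2 h; have := mul_self_nonneg β; linarith
    · have := mul_self_pos.2 h; have := mul_self_nonneg α; linarith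
  -- A trace-free block of B means a symmetric action, hence one that is diagonalizable over ℝ.
  have htrB : B 1 1 = -B 0 0 := by
    have : (α * α + β * β) * a * (B 0 0 + B 1 1) = 0 := by
      linear_combination α * a * (k8 - k13) - β * (k12 - k9)
        + α * (B 0 1 - B 1 0) * √(1 - a ^ 2) * hβs - α * β * (B 0 1 - B 1 0) * hs
        - (α * a * α * a + β * β) * hsym
    have := (mul_eq_zero.1 this).resolve_left (mul_ne_zero hR.ne' ha0)
    linear_combination this
  -- This identity makes corner times block trace positive, the sign condition required by
  -- `iso_of_diagonal`.
  have htrA : A 2 2 * (A 0 0 + A 1 1) * (α * α + β * β) =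
      A 2 2 * A 2 2 * (α * α + β * β * (a * a)) := by
    have : a * ((α * α + β * β) * (A 0 0 + A 1 1) - A 2 2 * (α * α + β * β * (a * a))) = 0 := by
      linear_combination β * a * (k8 - k13) + α * (k12 - k9) - α * β * (a * a - 1) * hsym
        - (α * α + β * β * (a * a)) * h4
    linear_combination A 2 2 * (mul_eq_zero.1 this).resolve_left ha0
  have hkt : 0 < A 2 2 * (A 0 0 + A 1 1) := by
    have : 0 < A 2 2 * (A 0 0 + A 1 1) * (α * α + β * β) := by
      rw [htrA]; exact mul_pos (mul_self_pos.2 hk) hP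
    exact pos_of_mul_pos_left this hR.le
  rw [eq_block a02 a12 a20 a21, ← sub_eq_zero.1 hsym] at hL₁
  rw [eq_block b02 b12 b20 b21, b22, htrB] at hL₂
  obtain ⟨x, y, hxy, hxy', hd⟩ := hL₁.exists_diagonal
  obtain ⟨u, v, huv, huv', hd'⟩ := hL₂.exists_planar
  -- Both factors are positive, so x y and u v have the same sign; this pairs the types of the two
  -- algebras.
  have hxyuv : x * y * (β * β + α * α * (a * a)) = u * v * (α * α + β * β * (a * a)) := by
    refine mul_right_cancel₀ hQ.ne' ?_
    rw [hxy', huv', hdet, htrB]; ring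
  obtain ⟨hsu, he, hsl⟩ := iso_of_diagonal hd (by rwa [hxy])
  obtain ⟨hr, hR0, hr'⟩ := iso_of_planar hd' (by rwa [huv])
  rcases lt_trichotomy (x * y) 0 with hlt | heq | hgt
  · have : u * v < 0 := by
      by_contra! hc
      exact absurd (mul_nonneg hc hP.le)
        (by rw [← hxyuv]; exact (mul_neg_of_neg_of_pos hlt hQ).not_ge)
    obtain ⟨μ, hμ, hμ', hi⟩ := hr' this
    exact Or.inr (Or.inr ⟨μ, hμ, hμ', hsl hlt, hi⟩)
  · have : u * v = 0 := by
      rw [heq, zero_mul] at hxyuv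
      exact (mul_eq_zero.1 hxyuv.symm).resolve_right hP.ne'
    exact Or.inl ⟨he heq, hR0 this⟩
  · have : 0 < u * v := by
      refine pos_of_mul_pos_left ?_ hP.le
      rw [← hxyuv]; exact mul_pos hgt hQ
    obtain ⟨μ, hμ, hμ', hi⟩ := hr this
    exact Or.inr (Or.inl ⟨μ, hμ, hμ', hsu hgt, hi⟩)

/-- With both corners zero, both blocks are symmetric and trace-free, so each determinant is minus a
sum of squares. By the determinant identity the two blocks vanish together, and a non-zero one
yields e(1,1). -/
theorem iso_e11_of_halfFlatEquations (hL₁ : Admits L₁ A) (hL₂ : Admits L₂ B)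
    (h : HalfFlatEquations A B a α β) (ha0 : a ≠ 0) (hne : α ≠ 0 ∨ β ≠ 0)
    (hA : A 2 2 = 0) (hB : B 2 2 = 0) : (A = 0 ∧ B = 0) ∨ (Iso L₁ e11 ∧ Iso L₂ e11) := by
  obtain ⟨a02, a12, a20, a21⟩ := h.block ha0 hne
  obtain ⟨b02, b12, b20, b21⟩ := h.symm.block ha0 hne.symm
  have hP := sq_add_sq_pos ha0 hne
  have hQ := sq_add_sq_pos ha0 hne.symm
  have hR : 0 < α * α + β * β := by
    rcases hne with h | h
    · have := mul_self_pos.2 h; have := mul_self_nonneg β; linarith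
    · have := mul_self_pos.2 h; have := mul_self_nonneg α; linarith
  have sA : A 1 0 = A 0 1 := by have := h.1.1; rw [hB] at this; linarith
  have sB : B 1 0 = B 0 1 := by have := h.1.2.2.2.1; rw [hA] at this; linarith
  have hdet := h.det_eq sA.symm
  obtain ⟨-, k1, k2, k3, k4, k5, k6, k7, k8, k9, k10, k11, k12, k13, k14, k15⟩ := h
  rw [sA] at k12 k13
  rw [sB] at k9 k13 hdet
  have tA : A 1 1 = -A 0 0 := by
    have : (α * α + β * β) * a * (A 0 0 + A 1 1) = 0 := by
      linear_combination β * a * (k8 - k13) + α * (k12 - k9)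
    have := (mul_eq_zero.1 this).resolve_left (mul_ne_zero hR.ne' ha0)
    linear_combination this
  have tB : B 1 1 = -B 0 0 := by
    have : (α * α + β * β) * a * (B 0 0 + B 1 1) = 0 := by
      linear_combination α * a * (k8 - k13) - β * (k12 - k9)
    have := (mul_eq_zero.1 this).resolve_left (mul_ne_zero hR.ne' ha0)
    linear_combination this
  rw [tA, tB] at hdet
  have hAB : (A 0 0 * A 0 0 + A 0 1 * A 0 1) * (β * β + α * α * (a * a)) =
      (B 0 0 * B 0 0 + B 0 1 * B 0 1) * (α * α + β * β * (a * a)) := by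
    refine mul_right_cancel₀ hQ.ne' ?_
    linear_combination -hdet
  have eA := eq_block a02 a12 a20 a21
  have eB := eq_block b02 b12 b20 b21
  rw [sA, tA, hA] at eA
  rw [sB, tB, hB] at eB
  by_cases h0 : A 0 0 * A 0 0 + A 0 1 * A 0 1 = 0
  · left
    have h0' : B 0 0 * B 0 0 + B 0 1 * B 0 1 = 0 := by
      rw [h0, zero_mul] at hAB
      exact (mul_eq_zero.1 hAB.symm).resolve_right hP.ne'
    obtain ⟨p, q⟩ := mul_self_add_mul_self_eq_zero.1 h0
    obtain ⟨p', q'⟩ := mul_self_add_mul_self_eq_zero.1 h0'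
    rw [p, q] at eA
    rw [p', q'] at eB
    constructor
    · rw [eA]; ext i j; fin_cases i <;> fin_cases j <;> simp
    · rw [eB]; ext i j; fin_cases i <;> fin_cases j <;> simp
  · right
    have h0' : B 0 0 * B 0 0 + B 0 1 * B 0 1 ≠ 0 := by
      intro h0'
      rw [h0', zero_mul] at hAB
      exact h0 ((mul_eq_zero.1 hAB).resolve_right hQ.ne')
    rw [eA] at hL₁
    rw [eB] at hL₂
    exact ⟨iso_of_admits (admits_of_traceless hL₁ h0) admits_e11_planar,
      iso_of_admits (admits_of_traceless hL₂ h0') admits_e11_planar⟩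

/-- At a = 1 and c = i every term with √(1-a²) drops out. The choices (p, r) = (1, -1), (1, 0), (1,
μ) cover all non-abelian pairs of type II. -/
theorem halfFlatEquations_planar (p r : ℝ) :
    HalfFlatEquations !![0, p, 0; -r, 0, 0; 0, 0, 0] (Matrix.diagonal ![-p, -r, -(p + r)])
      1 0 1 := by
  simp [HalfFlatEquations, Matrix.diagonal]

end TypeII

/-! ### Existence for the listed pairs, and the case a = 0. -/

section Existence

variable {L₁ L₂ : Type*} [LieRing L₁] [LieAlgebra ℝ L₁] [LieRing L₂] [LieAlgebra ℝ L₂]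

/-- The equations of half-flatness with parameter `a` are solved by structure matrices of the two
algebras; see `exists_halfFlat_iff`. -/
def HasHalfFlat (L₁ L₂ : Type*) [LieRing L₁] [LieAlgebra ℝ L₁] [LieRing L₂] [LieAlgebra ℝ L₂]
    (a : ℝ) : Prop :=
  ∃ A B α β, Admits L₁ A ∧ Admits L₂ B ∧ (α ≠ 0 ∨ β ≠ 0) ∧ HalfFlatEquations A B a α β

theorem HasHalfFlat.symm {a : ℝ} (h : HasHalfFlat L₁ L₂ a) : HasHalfFlat L₂ L₁ a := by
  obtain ⟨A, B, α, β, hA, hB, hne, h⟩ := h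
  exact ⟨B, A, β, α, hB, hA, hne.symm, h.symm⟩

theorem hasHalfFlat_of_planar {p r : ℝ} (h₁ : Admits L₁ !![0, p, 0; -r, 0, 0; 0, 0, 0])
    (h₂ : Admits L₂ (Matrix.diagonal ![p, r, p + r])) : HasHalfFlat L₁ L₂ 1 :=
  ⟨_, _, 0, 1, h₁, h₂.diagonal_neg, Or.inr one_ne_zero, halfFlatEquations_planar p r⟩

theorem hasHalfFlat_e11 (h₁ : Iso L₁ e11) (h₂ : Iso L₂ e11) : HasHalfFlat L₁ L₂ 1 := by
  refine hasHalfFlat_of_planar (p := 1) (r := -1) (admits_e11_planar.of_iso h₁.symm) ?_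
  simpa using (admits_e11.of_iso h₂.symm).diagonal_neg

theorem hasHalfFlat_e2 (h₁ : Iso L₁ e2) (h₂ : Iso L₂ Rr2) : HasHalfFlat L₁ L₂ 1 := by
  refine (hasHalfFlat_of_planar (p := 1) (r := 0) (admits_Rr2.of_iso h₂.symm) ?_).symm
  simpa using (admits_e2 one_pos one_pos).of_iso h₁.symm

theorem hasHalfFlat_su2 {μ : ℝ} (hμ : 0 < μ) (h₁ : Iso L₁ su2) (h₂ : Iso L₂ (r3 μ)) :
    HasHalfFlat L₁ L₂ 1 :=
  (hasHalfFlat_of_planar ((admits_r3 μ).of_iso h₂.symm)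
    ((admits_su2_of_pos one_pos hμ (by linarith)).of_iso h₁.symm)).symm

theorem hasHalfFlat_sl2 {μ : ℝ} (hμ : -1 < μ) (hμ' : μ < 0) (h₁ : Iso L₁ sl2)
    (h₂ : Iso L₂ (r3 μ)) : HasHalfFlat L₁ L₂ 1 :=
  (hasHalfFlat_of_planar ((admits_r3 μ).of_iso h₂.symm)
    ((admits_sl2_of_pos_of_neg one_pos hμ' (by linarith)).of_iso h₁.symm)).symm

theorem hasHalfFlat_of_isLieAbelian {A B : Matrix (Fin 3) (Fin 3) ℝ} (hA : Admits L₁ A)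
    (hB : Admits L₂ B) (h₁ : IsLieAbelian L₁) (h₂ : IsLieAbelian L₂) (a : ℝ) :
    HasHalfFlat L₁ L₂ a := by
  rw [isLieAbelian_iff hA] at h₁
  rw [isLieAbelian_iff hB] at h₂
  subst h₁ h₂
  exact ⟨0, 0, 1, 0, hA, hB, Or.inl one_ne_zero, by simp [HalfFlatEquations]⟩

/-- At a = 0 the six equations from ω ∧ ω say exactly that A and B are symmetric; those from Re Ψ
then reduce to the entries of βA + αB. -/
theorem halfFlatEquations_zero_iff {A B : Matrix (Fin 3) (Fin 3) ℝ} {α β : ℝ} :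
    HalfFlatEquations A B 0 α β ↔
      (A 0 1 = A 1 0 ∧ A 0 2 = A 2 0 ∧ A 1 2 = A 2 1) ∧
      (B 0 1 = B 1 0 ∧ B 0 2 = B 2 0 ∧ B 1 2 = B 2 1) ∧ β • A + α • B = 0 := by
  simp only [HalfFlatEquations]
  simp only [zero_mul, mul_zero, add_zero, sub_zero, ne_eq, OfNat.ofNat_ne_zero,
    not_false_eq_true, zero_pow, Real.sqrt_one, one_mul, mul_one, zero_add, neg_zero]
  constructor
  · rintro ⟨⟨h1, h2, h3, h4, h5, h6⟩, k1, k2, k3, k4, k5, k6, k7, k8, k9, k10, k11, k12, k13, k14,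
      k15⟩
    have a1 : A 0 1 = A 1 0 := by linarith
    have a2 : A 0 2 = A 2 0 := by linarith
    have a3 : A 1 2 = A 2 1 := by linarith
    have b1 : B 0 1 = B 1 0 := by linarith
    have b2 : B 0 2 = B 2 0 := by linarith
    have b3 : B 1 2 = B 2 1 := by linarith
    refine ⟨⟨a1, a2, a3⟩, ⟨b1, b2, b3⟩, ?_⟩
    rw [← a1] at k12
    rw [← a3] at k7
    rw [← b1] at k9
    rw [← b2] at k6
    rw [← b3] at k5
    rw [← a2] at k11
    ext i j
    fin_cases i <;> fin_cases j <;> simp [← a1, ← a2, ← a3, ← b1, ← b2, ← b3] <;> linarith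
  · rintro ⟨⟨a1, a2, a3⟩, ⟨b1, b2, b3⟩, h⟩
    have hent := fun i j => congrFun (congrFun h i) j
    simp only [Matrix.add_apply, Matrix.smul_apply, smul_eq_mul, Matrix.zero_apply] at hent
    have e00 := hent 0 0
    have e01 := hent 0 1
    have e02 := hent 0 2
    have e11 := hent 1 1
    have e12 := hent 1 2
    have e22 := hent 2 2
    simp only [← a1, ← a2, ← a3, ← b1, ← b2, ← b3, sub_self, mul_zero, true_and, and_true]
    refine ⟨?_, ?_, ?_, ?_, ?_, ?_, ?_, ?_, ?_⟩ <;> linarith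

theorem hasHalfFlat_zero_iff (hd₁ : finrank ℝ L₁ = 3) (hd₂ : finrank ℝ L₂ = 3) :
    HasHalfFlat L₁ L₂ 0 ↔
      (Iso L₁ L₂ ∧ IsUnimodular L₁ ∧ IsUnimodular L₂) ∨
      (¬ IsLieAbelian L₁ ∧ IsUnimodular L₁ ∧ IsLieAbelian L₂) ∨
      (¬ IsLieAbelian L₂ ∧ IsUnimodular L₂ ∧ IsLieAbelian L₁) := by
  constructor
  · rintro ⟨A, B, α, β, hA, hB, hne, h⟩
    rw [halfFlatEquations_zero_iff, ← isUnimodular_iff hA, ← isUnimodular_iff hB] at h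
    obtain ⟨uA, uB, h⟩ := h
    rw [isLieAbelian_iff hA, isLieAbelian_iff hB]
    by_cases hα : α = 0
    · have hA0 : A = 0 := by
        simpa [hα, (hne.resolve_left (not_not.2 hα))] using h
      by_cases hB0 : B = 0
      · subst hA0 hB0
        exact Or.inl ⟨iso_of_admits hA hB, uA, uB⟩
      · exact Or.inr (Or.inr ⟨hB0, uB, hA0⟩)
    by_cases hβ : β = 0
    · have hB0 : B = 0 := by simpa [hβ, hα] using h
      by_cases hA0 : A = 0
      · subst hA0 hB0
        exact Or.inl ⟨iso_of_admits hA hB, uA, uB⟩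
      · exact Or.inr (Or.inl ⟨hA0, uA, hB0⟩)
    -- With α and β both non-zero, B = -(β/α)A, and scaling a basis by -(β/α) scales its structure
    -- matrix by the same factor.
    have hs := hA.smul (neg_ne_zero.2 (div_ne_zero hβ hα))
    have hBA : (-(β / α)) • A = B := by
      have h' : B = α⁻¹ • (α • B) := (inv_smul_smul₀ hα B).symm
      rw [h', eq_neg_of_add_eq_zero_right h, smul_neg, smul_smul, neg_smul, div_eq_inv_mul]
    rw [hBA] at hs
    exact Or.inl ⟨iso_of_admits hs hB, uA, uB⟩
  · obtain ⟨A, hA⟩ := exists_admits hd₁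
    obtain ⟨B, hB⟩ := exists_admits hd₂
    rintro (⟨hi, uA, -⟩ | ⟨-, uA, aB⟩ | ⟨-, uB, aA⟩)
    · have sA := (isUnimodular_iff hA).1 uA
      exact ⟨A, A, 1, -1, hA, hA.of_iso hi, Or.inl one_ne_zero,
        halfFlatEquations_zero_iff.2 ⟨sA, sA, by simp⟩⟩
    · obtain rfl := (isLieAbelian_iff hB).1 aB
      exact ⟨A, 0, 1, 0, hA, hB, Or.inl one_ne_zero,
        halfFlatEquations_zero_iff.2 ⟨(isUnimodular_iff hA).1 uA, by simp, by simp⟩⟩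
    · obtain rfl := (isLieAbelian_iff hA).1 aA
      exact ⟨0, B, 0, 1, hA, hB, Or.inr one_ne_zero,
        halfFlatEquations_zero_iff.2 ⟨by simp, (isUnimodular_iff hB).1 uB, by simp⟩⟩

end Existence

end HalfFlat

/-! ### The classification. -/

theorem mainTheorem2 (g₁ : Type*) [LieRing g₁] [LieAlgebra ℝ g₁] (g₂ : Type*) [LieRing g₂]
    [LieAlgebra ℝ g₂] (h₁ : Module.finrank ℝ g₁ = 3) (h₂ : Module.finrank ℝ g₂ = 3) :
    ((∃ S : HalfFlat.SU3Structure (g₁ × g₂),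
        S.IsHalfFlat ∧ S.SummandsOrthogonal ∧ S.IsTypeI) ↔
      (HalfFlat.Iso g₁ g₂ ∧ HalfFlat.IsUnimodular g₁ ∧ HalfFlat.IsUnimodular g₂) ∨
      (¬ IsLieAbelian g₁ ∧ HalfFlat.IsUnimodular g₁ ∧ IsLieAbelian g₂) ∨
      (¬ IsLieAbelian g₂ ∧ HalfFlat.IsUnimodular g₂ ∧ IsLieAbelian g₁)) ∧
    ((∃ S : HalfFlat.SU3Structure (g₁ × g₂),
        S.IsHalfFlat ∧ S.SummandsOrthogonal ∧ S.IsTypeII) ↔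
      (IsLieAbelian g₁ ∧ IsLieAbelian g₂) ∨
      (HalfFlat.Iso g₁ HalfFlat.e11 ∧ HalfFlat.Iso g₂ HalfFlat.e11) ∨
      (HalfFlat.Iso g₁ HalfFlat.e2 ∧ HalfFlat.Iso g₂ HalfFlat.Rr2) ∨
      (HalfFlat.Iso g₂ HalfFlat.e2 ∧ HalfFlat.Iso g₁ HalfFlat.Rr2) ∨
      (∃ μ : ℝ, 0 < μ ∧ μ ≤ 1 ∧
        ((HalfFlat.Iso g₁ HalfFlat.su2 ∧ HalfFlat.Iso g₂ (HalfFlat.r3 μ)) ∨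
          (HalfFlat.Iso g₂ HalfFlat.su2 ∧ HalfFlat.Iso g₁ (HalfFlat.r3 μ)))) ∨
      (∃ μ : ℝ, -1 < μ ∧ μ < 0 ∧
        ((HalfFlat.Iso g₁ HalfFlat.sl2 ∧ HalfFlat.Iso g₂ (HalfFlat.r3 μ)) ∨
          (HalfFlat.Iso g₂ HalfFlat.sl2 ∧ HalfFlat.Iso g₁ (HalfFlat.r3 μ))))) := by
  refine ⟨(HalfFlat.exists_halfFlat_iff (by norm_num)).trans
    (HalfFlat.hasHalfFlat_zero_iff h₁ h₂), ?_⟩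
  constructor
  · rintro ⟨S, hS, ho, a, ha, ha1, ha0, hn⟩
    have hsq : a ^ 2 ≤ 1 := by nlinarith
    obtain ⟨A, B, α, β, hA, hB, hne, h⟩ :=
      (HalfFlat.exists_halfFlat_iff hsq).1 ⟨S, hS, ho, hn⟩
    -- The cases are: both corners vanish, or one does not; the symmetry of the equations handles a
    -- non-zero corner of B.
    by_cases hkA : A 2 2 = 0
    · by_cases hkB : B 2 2 = 0
      · rw [HalfFlat.isLieAbelian_iff hA, HalfFlat.isLieAbelian_iff hB]
        rcases HalfFlat.iso_e11_of_halfFlatEquations hA hB h ha0 hne hkA hkB with h | h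
        · exact Or.inl h
        · exact Or.inr (Or.inl h)
      · rcases HalfFlat.iso_of_halfFlatEquations hB hA h.symm hsq ha0 hne.symm hkB with
          h | ⟨μ, p, q, h⟩ | ⟨μ, p, q, h⟩
        · exact Or.inr (Or.inr (Or.inr (Or.inl h)))
        · exact Or.inr (Or.inr (Or.inr (Or.inr (Or.inl ⟨μ, p, q, Or.inr h⟩))))
        · exact Or.inr (Or.inr (Or.inr (Or.inr (Or.inr ⟨μ, p, q, Or.inr h⟩))))
    · rcases HalfFlat.iso_of_halfFlatEquations hA hB h hsq ha0 hne hkA with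
        h | ⟨μ, p, q, h⟩ | ⟨μ, p, q, h⟩
      · exact Or.inr (Or.inr (Or.inl h))
      · exact Or.inr (Or.inr (Or.inr (Or.inr (Or.inl ⟨μ, p, q, Or.inl h⟩))))
      · exact Or.inr (Or.inr (Or.inr (Or.inr (Or.inr ⟨μ, p, q, Or.inl h⟩))))
  · intro h
    -- The value a = 1 suffices for every pair in the list.
    have key : HalfFlat.HasHalfFlat g₁ g₂ 1 := by
      rcases h with ⟨k₁, k₂⟩ | ⟨k₁, k₂⟩ | ⟨k₁, k₂⟩ | ⟨k₁, k₂⟩ |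
        ⟨μ, p, q, ⟨k₁, k₂⟩ | ⟨k₁, k₂⟩⟩ | ⟨μ, p, q, ⟨k₁, k₂⟩ | ⟨k₁, k₂⟩⟩
      · obtain ⟨A, hA⟩ := HalfFlat.exists_admits h₁
        obtain ⟨B, hB⟩ := HalfFlat.exists_admits h₂
        exact HalfFlat.hasHalfFlat_of_isLieAbelian hA hB k₁ k₂ 1
      · exact HalfFlat.hasHalfFlat_e11 k₁ k₂
      · exact HalfFlat.hasHalfFlat_e2 k₁ k₂
      · exact (HalfFlat.hasHalfFlat_e2 k₁ k₂).symm
      · exact HalfFlat.hasHalfFlat_su2 p k₁ k₂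
      · exact (HalfFlat.hasHalfFlat_su2 p k₁ k₂).symm
      · exact HalfFlat.hasHalfFlat_sl2 p q k₁ k₂
      · exact (HalfFlat.hasHalfFlat_sl2 p q k₁ k₂).symm
    obtain ⟨S, hS, ho, hn⟩ := (HalfFlat.exists_halfFlat_iff (by norm_num)).2 key
    exact ⟨S, hS, ho, 1, by norm_num, le_rfl, one_ne_zero, hn⟩
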